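/- Conventions: $y^x=x^{-1}yx$, $[x,y]=x^{-1}y^{-1}xy$; $q\ge 0$ is an integer and $\mathbb{Z}_q=\mathbb{Z}/q\mathbb{Z}$ (so $\mathbb{Z}_0=\mathbb{Z}$). For a group $A$ and a normal subgroup $R$ of $A$, $A'$ is the derived subgroup, $R^q$ is the subgroup generated by all $r^q$ with $r\in R$, and $[R,A]$ is the subgroup generated by all $[r,a]$ with $r\in R$, $a\in A$. For a group $G$ let $G\otimes^q G$ be the group generated by the symbols $g\otimes h$ $(g,h\in G)$ and, if $q\ge 1$, $\widehat{k}$ $(k\in G)$, subject to $$g\otimes hh_1=(g\otimes h_1)(g^{h_1}\otimes h^{h_1}),\qquad gg_1\otimes h=(g^{g_1}\otimes h^{g_1})(g_1\otimes h),$$ and, if $q\ge 1$, also to $$(g\otimes h)^{\widehat{k}}=g^{k^q}\otimes h^{k^q},\qquad \widehat{kk_1}=\widehat{k}\,\prod_{i=1}^{q-1}\bigl(k^{x_i}\otimes (k_1^{-i})^{x_i}\bigr)\,\widehat{k_1}\quad (x_i=k^{q-1-i}),$$ $$[\widehat{k},\widehat{k_1}]=k^q\otimes k_1^q,\qquad \widehat{[g,h]}=(g\otimes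 h)^q,$$ for all $g,g_1,h,h_1,k,k_1\in G$, where the product is taken in increasing order of $i$. The $q$-exterior square $G\wedge^q G$ is the quotient of $G\otimes^q G$ by the central subgroup generated by all $g\otimes g$, $g\in G$. **Corollary.** Let $q\ge 0$, and let $G\cong F/R$ be a free presentation of a group $G$, that is, $R$ is the kernel of an epimorphism from a free group $F$ onto $G$ (for instance, a consistent polycyclic presentation $F_n/R$ of a polycyclic group $G$). Put $$E_q(G)=F/R^q[R,F],\qquad T_q=R/R^q[R,F]\le E_q(G).$$ Then (i) $G\wedge^q G\cong E_q(G)'\,E_q(G)^q$; (ii) $H_2(G,\mathbb{Z}_q)\cong \bigl(E_q(G)'\,E_q(G)^q\bigr)\cap T_q$, where $H_2(G,\mathbb{Z}_q)$ is the second homology group of $G$ with coefficients in the trivial $G$-module $\mathbb{Z}_q$. -/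

import Mathlib

namespace QExterior

universe u v

/-- The right conjugate `y ^ x = x⁻¹ y x`. -/
def rconj {G : Type u} [Group G] (y x : G) : G := x⁻¹ * y * x

/-- The commutator `[x, y] = x⁻¹ y⁻¹ x y`. -/
def rcomm {G : Type u} [Group G] (x y : G) : G := x⁻¹ * y⁻¹ * x * y

/-- The generating symbols of the `q`-tensor square of `G`: a symbol `g ⊗ h` for all `g, h` in `G`
and, only when `q ≥ 1`, a symbol `hat k` for every `k` in `G`. -/
inductive Gen (q : ℕ) (G : Type u) : Type u
  | tensor (g h : G) : Gen q G
  | hat (hq : 1 ≤ q) (k : G) : Gen q G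

/-- The symbol `g ⊗ h` in the free group on the generating symbols. -/
def tens (q : ℕ) {G : Type u} (g h : G) : FreeGroup (Gen q G) :=
  FreeGroup.of (Gen.tensor g h)

/-- The symbol `hat k` in the free group on the generating symbols. -/
def hat {q : ℕ} (hq : 1 ≤ q) {G : Type u} (k : G) : FreeGroup (Gen q G) :=
  FreeGroup.of (Gen.hat hq k)

/-- The defining relators of the `q`-tensor square. A relation `a = b` is written as the relator
`a * b⁻¹`. The relations that involve a symbol `hat k` are present only when `q ≥ 1`. -/
inductive TensorRel (q : ℕ) (G : Type u) [Group G] : FreeGroup (Gen q G) → Prop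
  /-- `g ⊗ h h₁ = (g ⊗ h₁) (g ^ h₁ ⊗ h ^ h₁)` -/
  | mul_right (g h h₁ : G) : TensorRel q G
      (tens q g (h * h₁) * (tens q g h₁ * tens q (rconj g h₁) (rconj h h₁))⁻¹)
  /-- `g g₁ ⊗ h = (g ^ g₁ ⊗ h ^ g₁) (g₁ ⊗ h)` -/
  | mul_left (g g₁ h : G) : TensorRel q G
      (tens q (g * g₁) h * (tens q (rconj g g₁) (rconj h g₁) * tens q g₁ h)⁻¹)
  /-- `(g ⊗ h) ^ (hat k) = g ^ (k ^ q) ⊗ h ^ (k ^ q)` -/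
  | conj_hat (hq : 1 ≤ q) (g h k : G) : TensorRel q G
      (rconj (tens q g h) (hat hq k) * (tens q (rconj g (k ^ q)) (rconj h (k ^ q)))⁻¹)
  /-- `hat (k k₁) = (hat k) (∏_{i = 1}^{q - 1} (k ⊗ k₁ ^ (-i)) ^ (k ^ (q - 1 - i))) (hat k₁)`, the
  product being taken in increasing order of `i`, with `(g ⊗ h) ^ x = g ^ x ⊗ h ^ x` -/
  | hat_mul (hq : 1 ≤ q) (k k₁ : G) : TensorRel q G
      (hat hq (k * k₁) *
        (hat hq k *
          ((List.range' 1 (q - 1)).map fun i =>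
            tens q (rconj k (k ^ (q - 1 - i))) (rconj ((k₁ ^ i)⁻¹) (k ^ (q - 1 - i)))).prod *
          hat hq k₁)⁻¹)
  /-- `[hat k, hat k₁] = k ^ q ⊗ k₁ ^ q` -/
  | comm_hat (hq : 1 ≤ q) (k k₁ : G) : TensorRel q G
      (rcomm (hat hq k) (hat hq k₁) * (tens q (k ^ q) (k₁ ^ q))⁻¹)
  /-- `hat [g, h] = (g ⊗ h) ^ q` -/
  | hat_comm (hq : 1 ≤ q) (g h : G) : TensorRel q G
      (hat hq (rcomm g h) * (tens q g h ^ q)⁻¹)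

/-- The `q`-tensor square `G ⊗^q G`; for `q = 0` it is the non-abelian tensor square. -/
abbrev TensorSquare (q : ℕ) (G : Type u) [Group G] : Type u :=
  PresentedGroup {r | TensorRel q G r}

/-- The diagonal subgroup `∇^q(G)`. The elements `g ⊗ g` are central in the `q`-tensor square, so
that the subgroup they generate is also the normal subgroup they generate. -/
def nabla (q : ℕ) (G : Type u) [Group G] : Subgroup (TensorSquare q G) :=
  Subgroup.normalClosure
    (Set.range fun g : G => (PresentedGroup.of (Gen.tensor g g) : TensorSquare q G))

instance (q : ℕ) (G : Type u) [Group G] : (nabla q G).Normal :=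
  Subgroup.normalClosure_normal

/-- The `q`-exterior square `G ∧^q G = (G ⊗^q G) / ∇^q(G)`. -/
abbrev ExteriorSquare (q : ℕ) (G : Type u) [Group G] : Type u :=
  TensorSquare q G ⧸ nabla q G

/-- The second homology group `H₂(G, ℤ_q)` with coefficients in the trivial module `ℤ_q = ℤ/qℤ`
(which is `ℤ` for `q = 0`). The lifts only adjust universes. -/
noncomputable abbrev H₂ (q : ℕ) (G : Type u) [Group G] : Type u :=
  groupHomology (Rep.trivial (ULift.{u} ℤ) G (ULift.{u} (ZMod q))) 2

/-- `H^q`: the subgroup generated by the `q`-th powers of the elements of the subgroup `H`. -/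
def powSubgroup {A : Type u} [Group A] (q : ℕ) (H : Subgroup A) : Subgroup A :=
  Subgroup.closure {x | ∃ h ∈ H, h ^ q = x}

instance {A : Type u} [Group A] (q : ℕ) (H : Subgroup A) [hH : H.Normal] :
    (powSubgroup q H).Normal := by
  refine ⟨fun x hx g => ?_⟩
  unfold powSubgroup at hx ⊢
  induction hx using Subgroup.closure_induction with
  | mem y hy =>
    obtain ⟨h, hh, rfl⟩ := hy
    exact Subgroup.subset_closure ⟨g * h * g⁻¹, hH.conj_mem h hh g, conj_pow⟩
  | one => simp
  | mul a b _ _ ha hb =>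
    have := mul_mem ha hb
    rwa [conj_mul] at this
  | inv a _ ha =>
    have := inv_mem ha
    rwa [conj_inv] at this

/-- `A' A^q`. -/
def derivedPow (q : ℕ) (A : Type u) [Group A] : Subgroup A :=
  commutator A ⊔ powSubgroup q ⊤

/-- `R^q [R, F]`, for a normal subgroup `R` of `F`. -/
def centralDenom {F : Type u} [Group F] (q : ℕ) (R : Subgroup F) : Subgroup F :=
  powSubgroup q R ⊔ ⁅R, (⊤ : Subgroup F)⁆

instance {F : Type u} [Group F] (q : ℕ) (R : Subgroup F) [R.Normal] :
    (centralDenom q R).Normal := by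
  unfold centralDenom
  infer_instance

/-- `E_q = F / R^q [R, F]`. -/
abbrev EExt {F : Type u} [Group F] (q : ℕ) (R : Subgroup F) [R.Normal] : Type u :=
  F ⧸ centralDenom q R

/-- `T_q = R / R^q [R, F]`, as a subgroup of `E_q`. -/
def Tq {F : Type u} [Group F] (q : ℕ) (R : Subgroup F) [R.Normal] : Subgroup (EExt q R) :=
  R.map (QuotientGroup.mk' (centralDenom q R))

end QExterior

/-! Part (i). The kernel `T_q` of `E_q(G) → G` is central of exponent `q`, so commutators and `q`-th
powers of lifts to `E_q(G)` depend only on elements of `G`, and they satisfy the relations of the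
exterior square. This gives `exteriorToE`, whose image is `E' E^q`. Its injectivity reduces to that
of the boundary map `bd` of `F`, because `R^q [R, F]` consists of boundaries of elements of `F ∧^q
F` that die in `G ∧^q G`: it is generated by the boundaries of the symbols `hat r` and `r ∧ f` with
`r ∈ R`.

For free `F` the injectivity of `bd` (`bd_injective_of_free`) comes from towers: groups `E` over `F`
that contain `F ∧^q F`, have commutators given by the exterior product, and are torsion-free modulo
`F ∧^q F`. Starting from `F ∧^q F` itself, semidirect products with `ℤ` bring any finite set of
basis elements into the image of `E`. Freeness then lifts a truncation of `F`, chosen to fix a given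
`m`, to `ρ : F → E`. The elements `ρ (bd m)` and `m` differ in `E` by a defect `u ^ q (hat (d
u))⁻¹`. The defect is a homomorphism with central values, and by torsion-freeness it is trivial as
soon as it lies in `F ∧^q F`. Hence `bd m = 1` forces `m = 1`.

Part (ii) is a Hopf formula, independent of (i). The cocycle of a section of `E_q(G) → G` induces a
map from `2`-chains to `T_q` that kills boundaries and sends cycles into `E' E^q`. The tautological
cocycle with values in `2`-chains modulo boundaries defines another central extension of `G` with
kernel of exponent `q`. Freeness of `F` maps `E_q(G)` to it over `G`, and this map detects
boundaries (`mem_range_δ₃`) and produces cycles (`exists_cycle`). -/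

namespace QExterior

universe u v w

/-! ### Conjugation, commutators and the collection formula -/

section Conjugation

variable {G : Type u} [Group G]

theorem rconj_mul (a b x : G) : rconj (a * b) x = rconj a x * rconj b x := by
  simp only [rconj]; group

theorem rconj_rconj (a x y : G) : rconj (rconj a x) y = rconj a (x * y) := by
  simp only [rconj]; group

@[simp] theorem rconj_one (a : G) : rconj a 1 = a := by simp [rconj]

@[simp] theorem one_rconj (x : G) : rconj 1 x = 1 := by simp [rconj]

@[simp] theorem rconj_self (x : G) : rconj x x = x := by simp [rconj]

theorem rconj_inv (a x : G) : rconj a⁻¹ x = (rconj a x)⁻¹ := by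
  simp only [rconj]; group

theorem rconj_pow (a x : G) (n : ℕ) : rconj (a ^ n) x = rconj a x ^ n := by
  induction n with
  | zero => simp
  | succ n ih => rw [pow_succ, pow_succ, rconj_mul, ih]

theorem rcomm_rconj (a b x : G) : rcomm (rconj a x) (rconj b x) = rconj (rcomm a b) x := by
  simp only [rcomm, rconj]; group

theorem rconj_eq_mul_rcomm (a x : G) : rconj a x = a * rcomm a x := by
  simp only [rcomm, rconj]; group

theorem map_rconj {H : Type v} [Group H] (f : G →* H) (a x : G) :
    f (rconj a x) = rconj (f a) (f x) := by simp [rconj]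

theorem map_rcomm {H : Type v} [Group H] (f : G →* H) (a x : G) :
    f (rcomm a x) = rcomm (f a) (f x) := by simp [rcomm]

/-- The collection formula behind the relation for `hat (k k₁)`. -/
theorem mul_pow_eq_prod_rcomm (a b : G) (n : ℕ) :
    (a * b) ^ n = a ^ n *
      ((List.range' 1 (n - 1)).map fun i =>
        rcomm (rconj a (a ^ (n - 1 - i))) (rconj ((b ^ i)⁻¹) (a ^ (n - 1 - i)))).prod * b ^ n := by
  rcases n with _ | n
  · simp
  -- The partial products telescope to a closed form; `j = n` is the claim for exponent `n + 1`.
  have key : ∀ j ≤ n, a ^ (n + 1) *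
      ((List.range' 1 j).map fun i =>
        rcomm (rconj a (a ^ (n - i))) (rconj ((b ^ i)⁻¹) (a ^ (n - i)))).prod =
        (a * b) ^ j * a * (b ^ j)⁻¹ * a ^ (n - j) := by
    intro j
    induction j with
    | zero => intro _; simp [pow_succ']
    | succ j ih =>
      intro hj
      rw [List.range'_1_concat, List.map_append, List.prod_append, ← mul_assoc, ih (by omega)]
      obtain ⟨d, rfl⟩ : ∃ d, n = j + 1 + d := ⟨n - (j + 1), by omega⟩
      have e1 : j + 1 + d - j = d + 1 := by omega
      have e2 : j + 1 + d - (j + 1) = d := by omega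
      simp only [List.map_cons, List.map_nil, List.prod_cons, List.prod_nil, mul_one, e1, e2,
        rcomm_rconj, add_comm 1 j]
      simp only [rcomm, rconj, pow_succ, pow_succ' a d]
      group
  have := key n le_rfl
  simp only [Nat.add_sub_cancel] at this ⊢
  rw [this]
  simp [pow_succ]
  group

theorem exists_central_mul {H : Type v} [Group H] (p : H →* G)
    (hc : ∀ t, p t = 1 → ∀ x, t * x = x * t) {x y : H} (hxy : p x = p y) :
    ∃ t, p t = 1 ∧ (∀ z, Commute t z) ∧ x = t * y := by
  have : p (x * y⁻¹) = 1 := by simp [hxy]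
  exact ⟨x * y⁻¹, this, hc _ this, by simp⟩

/-- Commutators depend only on the images modulo a central kernel. -/
theorem rcomm_eq_of_central {H : Type v} [Group H] (p : H →* G)
    (hc : ∀ t, p t = 1 → ∀ x, t * x = x * t) {x y x' y' : H} (hx : p x = p x')
    (hy : p y = p y') : rcomm x y = rcomm x' y' := by
  obtain ⟨t, -, ht, rfl⟩ := exists_central_mul p hc hx
  obtain ⟨t', -, ht', rfl⟩ := exists_central_mul p hc hy
  simp only [rcomm, mul_inv_rev]
  calc x'⁻¹ * t⁻¹ * (y'⁻¹ * t'⁻¹) * (t * x') * (t' * y')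
      = x'⁻¹ * (t⁻¹ * (y'⁻¹ * t'⁻¹)) * (t * x') * (t' * y') := by group
    _ = x'⁻¹ * y'⁻¹ * (t'⁻¹ * x') * (t' * y') := by rw [(ht _).inv_left.eq]; group
    _ = x'⁻¹ * y'⁻¹ * x' * y' := by rw [(ht' _).inv_left.eq]; group

theorem pow_eq_of_central {q : ℕ} {H : Type v} [Group H] (p : H →* G)
    (hc : ∀ t, p t = 1 → ∀ x, t * x = x * t) (hq : ∀ t, p t = 1 → t ^ q = 1) {x x' : H}
    (hx : p x = p x') : x ^ q = x' ^ q := by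
  obtain ⟨t, h1, ht, rfl⟩ := exists_central_mul p hc hx
  rw [(ht x').mul_pow, hq t h1, one_mul]

end Conjugation

/-! ### Pairings: the relations of the exterior square in an arbitrary group -/

/-- Functions `w` and `c` on `G` that satisfy the defining relations of the `q`-exterior square
(with `c` trivial for `q = 0`). -/
structure IsPairing (q : ℕ) {G : Type u} [Group G] {M : Type v} [Group M]
    (w : G → G → M) (c : G → M) : Prop where
  mul_right : ∀ g h h₁, w g (h * h₁) = w g h₁ * w (rconj g h₁) (rconj h h₁)
  mul_left : ∀ g g₁ h, w (g * g₁) h = w (rconj g g₁) (rconj h g₁) * w g₁ h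
  self : ∀ g, w g g = 1
  conj_hat : ∀ g h k, rconj (w g h) (c k) = w (rconj g (k ^ q)) (rconj h (k ^ q))
  hat_mul : ∀ k k₁, c (k * k₁) = c k *
    ((List.range' 1 (q - 1)).map fun i =>
      w (rconj k (k ^ (q - 1 - i))) (rconj ((k₁ ^ i)⁻¹) (k ^ (q - 1 - i)))).prod * c k₁
  comm_hat : ∀ k k₁, rcomm (c k) (c k₁) = w (k ^ q) (k₁ ^ q)
  hat_comm : ∀ g h, c (rcomm g h) = w g h ^ q
  hat_zero : q = 0 → ∀ k, c k = 1

namespace IsPairing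

variable {q : ℕ} {G : Type u} [Group G] {M : Type v} [Group M] {w : G → G → M} {c : G → M}

theorem comp (h : IsPairing q w c) {H : Type*} [Group H] (f : H →* G) :
    IsPairing q (fun a b => w (f a) (f b)) (fun k => c (f k)) where
  mul_right a b b₁ := by simp [map_rconj, h.mul_right]
  mul_left a b b₁ := by simp [map_rconj, h.mul_left]
  self a := h.self _
  conj_hat a b k := by simp [map_rconj, h.conj_hat]
  hat_mul a b := by simp [map_rconj, h.hat_mul]
  comm_hat a b := by simp [h.comm_hat]
  hat_comm a b := by simp [map_rcomm, h.hat_comm]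
  hat_zero hq k := h.hat_zero hq _

/-- The commutator and the `q`-th power on a group `H` that maps onto `G` with a central kernel of
exponent `q`, seen as functions on `G`. -/
theorem of_central {H : Type v} [Group H] (p : H →* G) (s : G → H) (hs : ∀ g, p (s g) = g)
    (hc : ∀ t, p t = 1 → ∀ x, t * x = x * t) (hq : ∀ t, p t = 1 → t ^ q = 1) :
    IsPairing q (fun g h => rcomm (s g) (s h)) (fun k => s k ^ q) := by
  have hcomm := fun x y x' y' => rcomm_eq_of_central p hc (x := x) (y := y) (x' := x') (y' := y')
  have hpow := fun x x' => pow_eq_of_central p hc hq (x := x) (x' := x')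
  -- Each chosen lift of a conjugate or power is traded for the same word in `s k` and `s k₁`, so
  -- that the collection formula applies.
  have hlist : ∀ k k₁ : G, ((List.range' 1 (q - 1)).map fun i =>
      rcomm (s (rconj k (k ^ (q - 1 - i)))) (s (rconj ((k₁ ^ i)⁻¹) (k ^ (q - 1 - i))))).prod =
      ((List.range' 1 (q - 1)).map fun i =>
        rcomm (rconj (s k) (s k ^ (q - 1 - i)))
          (rconj ((s k₁ ^ i)⁻¹) (s k ^ (q - 1 - i)))).prod := by
    intro k k₁
    congr 1
    refine List.map_congr_left fun i _ => hcomm _ _ _ _ ?_ ?_ <;> simp [hs, map_rconj]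
  refine ⟨fun g h h₁ => ?_, fun g g₁ h => ?_, fun g => by simp [rcomm], fun g h k => ?_,
    fun k k₁ => ?_, fun k k₁ => ?_, fun g h => ?_, fun h0 k => by simp [h0]⟩
  · rw [hcomm (s g) (s (h * h₁)) (s g) (s h * s h₁) rfl (by simp [hs]),
      hcomm (s (rconj g h₁)) _ (rconj (s g) (s h₁)) (rconj (s h) (s h₁)) (by simp [hs, map_rconj])
        (by simp [hs, map_rconj])]
    simp only [rcomm, rconj]; group
  · rw [hcomm (s (g * g₁)) (s h) (s g * s g₁) (s h) (by simp [hs]) rfl,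
      hcomm (s (rconj g g₁)) _ (rconj (s g) (s g₁)) (rconj (s h) (s g₁)) (by simp [hs, map_rconj])
        (by simp [hs, map_rconj])]
    simp only [rcomm, rconj]; group
  · rw [hcomm (s (rconj g (k ^ q))) _ (rconj (s g) (s k ^ q)) (rconj (s h) (s k ^ q))
      (by simp [hs, map_rconj]) (by simp [hs, map_rconj]), rcomm_rconj]
  · rw [hlist, ← mul_pow_eq_prod_rcomm]
    exact hpow _ _ (by simp [hs])
  · exact hcomm _ _ _ _ (by simp [hs]) (by simp [hs])
  · exact hpow _ _ (by simp [hs, map_rcomm])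

end IsPairing

/-! ### The exterior square as the universal target of pairings -/

section Exterior

variable (q : ℕ) {G : Type u} [Group G]

/-- The class of `g ⊗ h` in the `q`-exterior square. -/
def wedge (g h : G) : ExteriorSquare q G :=
  QuotientGroup.mk' (nabla q G) (PresentedGroup.of (Gen.tensor g h))

/-- The class of `hat k` in the `q`-exterior square, read as `1` for `q = 0`. -/
def hatE (k : G) : ExteriorSquare q G :=
  if hq : 1 ≤ q then QuotientGroup.mk' (nabla q G) (PresentedGroup.of (Gen.hat hq k)) else 1

/-- The projection of the free group on the symbols onto the `q`-exterior square. -/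
def symbolHom (G : Type u) [Group G] : FreeGroup (Gen q G) →* ExteriorSquare q G :=
  (QuotientGroup.mk' (nabla q G)).comp (PresentedGroup.mk _)

theorem symbolHom_tens (g h : G) : symbolHom q G (tens q g h) = wedge q g h := rfl

theorem symbolHom_hat (hq : 1 ≤ q) (k : G) : symbolHom q G (hat hq k) = hatE q k := by
  rw [hatE, dif_pos hq]; rfl

theorem symbolHom_rel {a b : FreeGroup (Gen q G)} (h : TensorRel q G (a * b⁻¹)) :
    symbolHom q G a = symbolHom q G b := by
  have : (PresentedGroup.mk {r | TensorRel q G r}) (a * b⁻¹) = 1 :=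
    PresentedGroup.one_of_mem h
  rw [← mul_inv_eq_one, ← map_inv, ← map_mul]
  simp only [symbolHom, MonoidHom.comp_apply, this, map_one]

/-- For `q = 0` there are no relators with `hat`; the corresponding identities then hold because
`hatE` is `1` and `1 ∧ 1 = 1`. -/
theorem isPairing_wedge : IsPairing q (wedge q (G := G)) (hatE q) := by
  have zero : q = 0 → ∀ k : G, hatE q k = 1 := fun h k => dif_neg (by omega)
  have one_r : ∀ g : G, wedge q g 1 = 1 := fun g => by
    have := symbolHom_rel q (TensorRel.mul_right g 1 1)
    simpa [symbolHom_tens] using this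
  refine ⟨fun g h h₁ => ?_, fun g g₁ h => ?_, fun g => ?_, fun g h k => ?_,
    fun k k₁ => ?_, fun k k₁ => ?_, fun g h => ?_, zero⟩
  · simpa [symbolHom_tens] using symbolHom_rel q (TensorRel.mul_right g h h₁)
  · simpa [symbolHom_tens] using symbolHom_rel q (TensorRel.mul_left g g₁ h)
  · exact (QuotientGroup.eq_one_iff _).2 (Subgroup.subset_normalClosure ⟨g, rfl⟩)
  · rcases Nat.eq_zero_or_pos q with h0 | hq
    · simp [h0, zero h0]
    · simpa [symbolHom_tens, symbolHom_hat, map_rconj] using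
        symbolHom_rel q (TensorRel.conj_hat hq g h k)
  · rcases Nat.eq_zero_or_pos q with h0 | hq
    · simp [h0, zero h0]
    · simpa [symbolHom_tens, symbolHom_hat, map_rconj, map_list_prod, Function.comp_def] using
        symbolHom_rel q (TensorRel.hat_mul hq k k₁)
  · rcases Nat.eq_zero_or_pos q with h0 | hq
    · simp [zero h0, h0, rcomm, one_r]
    · simpa [symbolHom_tens, symbolHom_hat, map_rcomm] using
        symbolHom_rel q (TensorRel.comm_hat hq k k₁)
  · rcases Nat.eq_zero_or_pos q with h0 | hq
    · simp [h0, zero h0]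
    · simpa [symbolHom_tens, symbolHom_hat, map_rcomm] using
        symbolHom_rel q (TensorRel.hat_comm hq g h)

variable {q}

theorem closure_wedge_hat (q : ℕ) (G : Type u) [Group G] :
    Subgroup.closure (Set.range (fun x : G × G => wedge q x.1 x.2) ∪ Set.range (hatE q (G := G)))
      = ⊤ := by
  rw [eq_top_iff]
  rintro x -
  obtain ⟨y, rfl⟩ := QuotientGroup.mk'_surjective _ x
  obtain ⟨z, rfl⟩ := PresentedGroup.mk_surjective _ y
  change symbolHom q G z ∈ _
  induction z using FreeGroup.induction_on with
  | C1 => simp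
  | of s =>
    rcases s with ⟨g, h⟩ | ⟨hq, k⟩
    · exact Subgroup.subset_closure (Or.inl ⟨(g, h), rfl⟩)
    · exact Subgroup.subset_closure (Or.inr ⟨k, (symbolHom_hat q hq k).symm⟩)
  | inv_of s h => rw [map_inv]; exact inv_mem h
  | mul a b ha hb => rw [map_mul]; exact mul_mem ha hb

theorem exterior_induction {P : ExteriorSquare q G → Prop} (wd : ∀ g h, P (wedge q g h))
    (ht : ∀ k, P (hatE q k)) (one : P 1) (mul : ∀ a b, P a → P b → P (a * b))
    (inv : ∀ a, P a → P a⁻¹) (m : ExteriorSquare q G) : P m := by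
  have hm : m ∈ Subgroup.closure (Set.range (fun x : G × G => wedge q x.1 x.2) ∪
      Set.range (hatE q (G := G))) := by rw [closure_wedge_hat]; trivial
  induction hm using Subgroup.closure_induction with
  | mem x hx =>
    rcases hx with ⟨y, rfl⟩ | ⟨k, rfl⟩
    · exact wd _ _
    · exact ht _
  | one => exact one
  | mul a b _ _ ha hb => exact mul a b ha hb
  | inv a _ ha => exact inv a ha

theorem exterior_hom_ext {H : Type v} [Group H] {f f' : ExteriorSquare q G →* H}
    (wd : ∀ g h, f (wedge q g h) = f' (wedge q g h)) (ht : ∀ k, f (hatE q k) = f' (hatE q k)) :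
    f = f' := by
  refine MonoidHom.ext fun m => ?_
  induction m using exterior_induction with
  | wd g h => exact wd g h
  | ht k => exact ht k
  | one => simp
  | mul a b ha hb => simp [ha, hb]
  | inv a ha => simp [ha]

namespace IsPairing

variable {M : Type v} [Group M] {w : G → G → M} {c : G → M} (h : IsPairing q w c)

/-- The values of a pairing on the symbols. -/
def genMap (_ : IsPairing q w c) : Gen q G → M
  | .tensor g h => w g h
  | .hat _ k => c k

/-- The homomorphism out of the `q`-tensor square that belongs to a pairing. -/
def tensorLift : TensorSquare q G →* M :=
  PresentedGroup.toGroup (f := h.genMap) (by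
    have ht : ∀ a b, FreeGroup.lift h.genMap (tens q a b) = w a b := fun a b => by
      simp [tens, genMap]
    have hh : ∀ hq a, FreeGroup.lift h.genMap (hat hq a) = c a := fun hq a => by
      simp [hat, genMap]
    rintro r (⟨a, b, b₁⟩ | ⟨a, a₁, b⟩ | ⟨hq, a, b, k⟩ | ⟨hq, k, k₁⟩ | ⟨hq, k, k₁⟩ | ⟨hq, a, b⟩) <;>
    rw [map_mul, map_inv, mul_inv_eq_one]
    · simp only [map_mul, ht, h.mul_right a]
    · simp only [map_mul, ht, h.mul_left]
    · simp only [map_rconj, ht, hh, h.conj_hat]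
    · simp only [map_mul, map_list_prod, List.map_map, Function.comp_def, ht, hh]
      exact h.hat_mul k k₁
    · simp only [map_rcomm, ht, hh, h.comm_hat]
    · simp only [map_pow, ht, hh, h.hat_comm])

/-- The homomorphism out of the `q`-exterior square that belongs to a pairing. -/
def lift : ExteriorSquare q G →* M :=
  QuotientGroup.lift (nabla q G) h.tensorLift (by
    intro x hx
    refine Subgroup.normalClosure_le_normal ?_ hx
    rintro _ ⟨g, rfl⟩
    simp only [SetLike.mem_coe, MonoidHom.mem_ker, tensorLift, PresentedGroup.toGroup.of]
    exact h.self g)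

@[simp] theorem lift_wedge (a b : G) : h.lift (wedge q a b) = w a b := by
  simp only [lift, wedge, QuotientGroup.mk'_apply, QuotientGroup.lift_mk, tensorLift,
    PresentedGroup.toGroup.of, genMap]

@[simp] theorem lift_hat (k : G) : h.lift (hatE q k) = c k := by
  by_cases hq : 1 ≤ q
  · simp only [lift, hatE, dif_pos hq, QuotientGroup.mk'_apply, QuotientGroup.lift_mk, tensorLift,
      PresentedGroup.toGroup.of, genMap]
  · rw [hatE, dif_neg hq, map_one, h.hat_zero (by omega)]

end IsPairing

end Exterior

/-! ### Identities valid in every pairing -/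

namespace IsPairing

variable {q : ℕ} {G : Type u} [Group G] {M : Type v} [Group M] {w : G → G → M} {c : G → M}

theorem one_right (h : IsPairing q w c) (g : G) : w g 1 = 1 := by
  simpa using h.mul_right g 1 1

theorem one_left (h : IsPairing q w c) (g : G) : w 1 g = 1 := by
  simpa using h.mul_left 1 1 g

/-- Expanding `w (g k) (g k) = 1` gives the identity for the conjugate of `g` by `k`, and every
element is such a conjugate. -/
theorem swap (h : IsPairing q w c) (g k : G) : w g k * w k g = 1 := by
  have h2 : ∀ a, w a (a * k) = w a k := fun a => by
    rw [h.mul_right, h.self, mul_one]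
  have key : ∀ g, w (rconj g k) k * w k (rconj g k) = 1 := fun g => by
    have h1 := h.self (g * k)
    rwa [h.mul_left, show rconj (g * k) k = rconj g k * k by rw [rconj_mul, rconj_self], h2,
      show w k (g * k) = w k (rconj g k) by
        rw [h.mul_right, h.self, one_mul, rconj_self]] at h1
  simpa [rconj_rconj] using key (rconj g k⁻¹)

theorem inv_eq_swap (h : IsPairing q w c) (g k : G) : (w g k)⁻¹ = w k g :=
  inv_eq_of_mul_eq_one_right (h.swap g k)

/-- Both sides arise by expanding `w (g g₁) (k k₁)`, on the left first or on the right first, and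
cancelling the common outer factors. -/
theorem mul_conj_eq (h : IsPairing q w c) (g k g₁ k₁ : G) :
    w (rconj g (k₁ * g₁)) (rconj k (k₁ * g₁)) * w g₁ k₁ =
      w g₁ k₁ * w (rconj g (g₁ * k₁)) (rconj k (g₁ * k₁)) := by
  have h1 : w (g * g₁) (k * k₁) = w (rconj g g₁) (rconj k₁ g₁) *
      w (rconj g (k₁ * g₁)) (rconj k (k₁ * g₁)) * (w g₁ k₁ * w (rconj g₁ k₁) (rconj k k₁)) := by
    rw [h.mul_left, rconj_mul, h.mul_right, h.mul_right g₁, rconj_rconj, rconj_rconj,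
      show g₁ * rconj k₁ g₁ = k₁ * g₁ by simp only [rconj]; group]
  have h2 : w (g * g₁) (k * k₁) = w (rconj g g₁) (rconj k₁ g₁) * w g₁ k₁ *
      (w (rconj g (g₁ * k₁)) (rconj k (g₁ * k₁)) * w (rconj g₁ k₁) (rconj k k₁)) := by
    rw [h.mul_right, rconj_mul, h.mul_left, h.mul_left (rconj g k₁), rconj_rconj, rconj_rconj,
      show k₁ * rconj g₁ k₁ = g₁ * k₁ by simp only [rconj]; group]
  rw [h1] at h2
  have h3 := mul_left_cancel (a := w (rconj g g₁) (rconj k₁ g₁)) (by simpa only [mul_assoc] using h2)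
  exact mul_right_cancel (b := w (rconj g₁ k₁) (rconj k k₁)) (by simpa only [mul_assoc] using h3)

theorem conj_wedge (h : IsPairing q w c) (g k g₁ k₁ : G) :
    rconj (w g k) (w g₁ k₁) = w (rconj g (rcomm g₁ k₁)) (rconj k (rcomm g₁ k₁)) := by
  have := h.mul_conj_eq (rconj g (k₁ * g₁)⁻¹) (rconj k (k₁ * g₁)⁻¹) g₁ k₁
  simp only [rconj_rconj, inv_mul_cancel, rconj_one] at this
  rw [show rcomm g₁ k₁ = (k₁ * g₁)⁻¹ * (g₁ * k₁) by simp only [rcomm]; group, rconj, mul_assoc,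
    this, inv_mul_cancel_left]

/-- Expand `w g (k f)` both directly and after writing `k f = (k f k⁻¹) k`. The action of `f` thus
becomes right multiplication by a factor that sees only the boundary of `w g k`, which is how it
extends to towers. -/
theorem conj_eq_mul_rcomm (h : IsPairing q w c) (g k f : G) :
    w (rconj g f) (rconj k f) = w g k * w (rcomm g k) f := by
  have h1 : w g f * w (rconj g f) (rconj k f) = w g k * w (rconj g k) f := by
    rw [← h.mul_right, show k * f = rconj f k⁻¹ * k by simp [rconj], h.mul_right, rconj_rconj]
    simp
  have h2 : w (rconj g⁻¹ g) (rconj f g) = (w g f)⁻¹ := by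
    rw [eq_inv_iff_mul_eq_one, ← h.mul_left, inv_mul_cancel, h.one_left]
  have h3 : w (rcomm g k) f = (w g k)⁻¹ * (w g f)⁻¹ * w g k * w (rconj g k) f := by
    rw [show rcomm g k = g⁻¹ * rconj g k by simp only [rcomm, rconj]; group, h.mul_left,
      show rconj g k = g * rcomm g k by simp only [rcomm, rconj]; group, ← rconj_rconj,
      ← rconj_rconj f, ← h.conj_wedge, h2]
    simp only [rconj]
  rw [h3, ← mul_assoc, ← mul_assoc, ← mul_assoc, mul_inv_cancel, one_mul, mul_assoc, ← h1,
    inv_mul_cancel_left]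

theorem self_pow (h : IsPairing q w c) (k : G) (n : ℕ) : w k (k ^ n) = 1 := by
  induction n with
  | zero => simpa using h.one_right k
  | succ n ih => rw [pow_succ, h.mul_right, h.self, rconj_pow, rconj_self, ih, one_mul]

theorem self_pow_inv (h : IsPairing q w c) (k : G) (n : ℕ) : w k (k ^ n)⁻¹ = 1 := by
  have e : rconj k (k ^ n) = k := by
    simp only [rconj]
    rw [mul_assoc, ← pow_succ', pow_succ, inv_mul_cancel_left]
  have := h.mul_right k (k ^ n)⁻¹ (k ^ n)
  rw [inv_mul_cancel, h.one_right, h.self_pow, one_mul, e, rconj_inv, rconj_self] at this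
  exact this.symm

theorem hat_one (h : IsPairing q w c) : c 1 = 1 := by
  have := h.hat_comm 1 1
  simpa [rcomm, h.self] using this

/-- The correction factors in the relation for `hat` pair `k` with inverses of its own powers, hence
vanish. -/
theorem hat_pow (h : IsPairing q w c) (k : G) (n : ℕ) : c (k ^ n) = c k ^ n := by
  induction n with
  | zero => simpa using h.hat_one
  | succ n ih =>
    rw [pow_succ', h.hat_mul, List.prod_eq_one, mul_one, ih, pow_succ']
    intro x hx
    obtain ⟨i, -, rfl⟩ := List.mem_map.1 hx
    have e : rconj k (k ^ (q - 1 - i)) = k := by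
      simp only [rconj]
      rw [mul_assoc, ← pow_succ', pow_succ, inv_mul_cancel_left]
    rw [rconj_inv, rconj_pow, rconj_pow, e, ← pow_mul, h.self_pow_inv]

theorem map (h : IsPairing q w c) {H : Type*} [Group H] (f : M →* H) :
    IsPairing q (fun a b => f (w a b)) (fun k => f (c k)) where
  mul_right a b b₁ := by rw [h.mul_right, map_mul]
  mul_left a b b₁ := by rw [h.mul_left, map_mul]
  self a := by rw [h.self, map_one]
  conj_hat a b k := by rw [← map_rconj, h.conj_hat]
  hat_mul a b := by simp [h.hat_mul, map_list_prod, Function.comp_def]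
  comm_hat a b := by rw [← map_rcomm, h.comm_hat]
  hat_comm a b := by rw [h.hat_comm, map_pow]
  hat_zero hq k := by rw [h.hat_zero hq, map_one]

/-- A homomorphism `d : M → G` carries commutators to the pairing once it does so on generators. -/
theorem rcomm_eq_of_generators (h : IsPairing q w c) (d : M →* G) (S : Set M)
    (hS : Subgroup.closure S = ⊤)
    (hconj : ∀ u ∈ S, ∀ a b, rconj (w a b) u = w (rconj a (d u)) (rconj b (d u)))
    (hcomm : ∀ u ∈ S, ∀ v ∈ S, rcomm u v = w (d u) (d v)) (u v : M) :
    rcomm u v = w (d u) (d v) := by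
  have hconj' : ∀ u a b, rconj (w a b) u = w (rconj a (d u)) (rconj b (d u)) := by
    intro u
    have hu : u ∈ Subgroup.closure S := hS ▸ Subgroup.mem_top u
    induction hu using Subgroup.closure_induction with
    | mem x hx => exact hconj x hx
    | one => simp
    | mul x y _ _ hx hy => intro a b; simp only [map_mul, ← rconj_rconj, hx, hy]
    | inv x _ hx =>
      intro a b
      have := hx (rconj a (d x)⁻¹) (rconj b (d x)⁻¹)
      simp only [rconj_rconj, inv_mul_cancel, rconj_one] at this
      rw [← this, rconj_rconj, mul_inv_cancel, rconj_one, map_inv]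
  have mul_l : ∀ x y v, rcomm x v = w (d x) (d v) → rcomm y v = w (d y) (d v) →
      rcomm (x * y) v = w (d (x * y)) (d v) := by
    intro x y v hx hy
    rw [map_mul, h.mul_left, ← hconj', ← hx, ← hy]
    simp only [rcomm, rconj]; group
  have mul_r : ∀ u x y, rcomm u x = w (d u) (d x) → rcomm u y = w (d u) (d y) →
      rcomm u (x * y) = w (d u) (d (x * y)) := by
    intro u x y hx hy
    rw [map_mul, h.mul_right, ← hconj', ← hx, ← hy]
    simp only [rcomm, rconj]; group
  -- Both sides solve the equation obtained by expanding the product `x⁻¹ x` in the left slot.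
  have inv_l : ∀ x v, rcomm x v = w (d x) (d v) → rcomm x⁻¹ v = w (d x⁻¹) (d v) := by
    intro x v hx
    have := h.mul_left (d x⁻¹) (d x) (d v)
    rw [← map_mul, inv_mul_cancel, map_one, h.one_left, ← hconj', ← hx] at this
    have e : rconj (rcomm x⁻¹ v) x * rcomm x v = 1 := by
      simp only [rcomm, rconj]; group
    rw [← e, mul_left_inj] at this
    simpa [rconj] using this
  have inv_r : ∀ u x, rcomm u x = w (d u) (d x) → rcomm u x⁻¹ = w (d u) (d x⁻¹) := by
    intro v x hx
    have h1 := inv_l x v (by rw [← h.inv_eq_swap, ← hx]; simp only [rcomm]; group)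
    rw [← h.inv_eq_swap, ← h1]; simp only [rcomm]; group
  have hu : u ∈ Subgroup.closure S := hS ▸ Subgroup.mem_top u
  induction hu using Subgroup.closure_induction with
  | mem x hx =>
    have hv : v ∈ Subgroup.closure S := hS ▸ Subgroup.mem_top v
    induction hv using Subgroup.closure_induction with
    | mem y hy => exact hcomm x hx y hy
    | one => simp [rcomm, h.one_right]
    | mul a b _ _ ha hb => exact mul_r x a b ha hb
    | inv a _ ha => exact inv_r x a ha
  | one => simp [rcomm, h.one_left]
  | mul a b _ _ ha hb => exact mul_l a b v ha hb
  | inv a _ ha => exact inv_l a v ha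

end IsPairing

/-! ### The boundary map and functoriality -/

variable (q : ℕ) {G : Type u} [Group G]

/-- The boundary map `g ∧ h ↦ [g, h]`, `hat k ↦ k ^ q`. -/
def bd : ExteriorSquare q G →* G :=
  (IsPairing.of_central (q := q) (MonoidHom.id G) id (fun _ => rfl)
    (fun t (ht : t = 1) x => by simp [ht]) (fun t (ht : t = 1) => by simp [ht])).lift

@[simp] theorem bd_wedge (g h : G) : bd q (wedge q g h) = rcomm g h :=
  IsPairing.lift_wedge _ _ _

@[simp] theorem bd_hat (k : G) : bd q (hatE q k) = k ^ q :=
  IsPairing.lift_hat _ _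

/-- The homomorphism of exterior squares induced by a homomorphism of groups. -/
def mapE {H : Type v} [Group H] (f : G →* H) : ExteriorSquare q G →* ExteriorSquare q H :=
  ((isPairing_wedge q).comp f).lift

@[simp] theorem mapE_wedge {H : Type v} [Group H] (f : G →* H) (g h : G) :
    mapE q f (wedge q g h) = wedge q (f g) (f h) :=
  IsPairing.lift_wedge _ _ _

@[simp] theorem mapE_hat {H : Type v} [Group H] (f : G →* H) (k : G) :
    mapE q f (hatE q k) = hatE q (f k) :=
  IsPairing.lift_hat _ _

/-- It suffices to treat generators. Conjugating `a ∧ b` by a generator is the action of its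
boundary, and `conj_eq_mul_rcomm` converts this action into a commutator; two `hat` symbols are
covered by a defining relation, and antisymmetry settles the remaining order. -/
theorem rcomm_eq_wedge_bd (m n : ExteriorSquare q G) :
    rcomm m n = wedge q (bd q m) (bd q n) := by
  have W := isPairing_wedge q (G := G)
  have hc : ∀ a b k : G, ∀ n : ExteriorSquare q G,
      rconj (wedge q a b) n = wedge q (rconj a k) (rconj b k) →
      rcomm (wedge q a b) n = wedge q (rcomm a b) k := by
    intro a b k n hn
    rw [W.conj_eq_mul_rcomm, rconj_eq_mul_rcomm] at hn
    exact mul_left_cancel hn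
  have hsw : ∀ m n : ExteriorSquare q G, rcomm m n = wedge q (bd q m) (bd q n) →
      rcomm n m = wedge q (bd q n) (bd q m) := by
    intro m n h
    rw [← W.inv_eq_swap, ← h]; simp only [rcomm]; group
  refine W.rcomm_eq_of_generators (bd q) _ (closure_wedge_hat q G) ?_ ?_ m n
  · rintro _ (⟨⟨g, k⟩, rfl⟩ | ⟨k, rfl⟩) a b
    · rw [bd_wedge, W.conj_wedge]
    · rw [bd_hat, W.conj_hat]
  · rintro _ (⟨⟨g, k⟩, rfl⟩ | ⟨k, rfl⟩) _ (⟨⟨g', k'⟩, rfl⟩ | ⟨k', rfl⟩)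
    · rw [bd_wedge, bd_wedge]; exact hc _ _ _ _ (W.conj_wedge _ _ _ _)
    · rw [bd_wedge, bd_hat]; exact hc _ _ _ _ (W.conj_hat _ _ _)
    · refine hsw _ _ ?_
      rw [bd_wedge, bd_hat]; exact hc _ _ _ _ (W.conj_hat _ _ _)
    · rw [bd_hat, bd_hat, W.comm_hat]

/-! ### Towers over the exterior square -/

variable {q : ℕ} {G : Type u} [Group G]

/-- A group `E` over `G` that contains `G ∧^q G` as a normal subgroup with torsion-free quotient
and whose commutators are given by the exterior product. -/
structure IsTower {E : Type v} [Group E] (d : E →* G) (j : ExteriorSquare q G →* E) : Prop where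
  injective : Function.Injective j
  d_j : ∀ m, d (j m) = bd q m
  comm : ∀ u v, rcomm u v = j (wedge q (d u) (d v))
  torsion_free : ∀ (u : E) (n : ℤ), n ≠ 0 → u ^ n ∈ j.range → u ∈ j.range

theorem isTower_id : IsTower (bd q (G := G)) (MonoidHom.id (ExteriorSquare q G)) where
  injective := Function.injective_id
  d_j _ := rfl
  comm := rcomm_eq_wedge_bd q
  torsion_free u _ _ _ := ⟨u, rfl⟩

namespace IsTower

variable {E : Type v} [Group E] {d : E →* G} {j : ExteriorSquare q G →* E}

theorem isPairing (_ : IsTower d j) :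
    IsPairing q (fun a b => j (wedge q a b)) (fun k => j (hatE q k)) :=
  (isPairing_wedge q).map j

theorem conj_wedge (h : IsTower d j) (a b : G) (u : E) :
    rconj (j (wedge q a b)) u = j (wedge q (rconj a (d u)) (rconj b (d u))) := by
  rw [h.isPairing.conj_eq_mul_rcomm, rconj_eq_mul_rcomm, h.comm, h.d_j, bd_wedge]

/-- The endomorphism `u ↦ u (d u ∧ f⁻¹)`, which is the action of `f` on the left. -/
def actHom (h : IsTower d j) (f : G) : E →* E where
  toFun u := u * j (wedge q (d u) f⁻¹)
  map_one' := by simp [h.isPairing.one_left]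
  map_mul' u v := by
    rw [map_mul, h.isPairing.mul_left, ← h.conj_wedge]
    simp only [rconj]; group

theorem actHom_apply (h : IsTower d j) (f : G) (u : E) :
    h.actHom f u = u * j (wedge q (d u) f⁻¹) := rfl

theorem actHom_wedge (h : IsTower d j) (f a b : G) : h.actHom f (j (wedge q a b)) =
    j (wedge q (rconj a f⁻¹) (rconj b f⁻¹)) := by
  rw [actHom_apply, h.isPairing.conj_eq_mul_rcomm, h.d_j, bd_wedge]

theorem actHom_mul (h : IsTower d j) (f f' : G) (u : E) :
    h.actHom (f * f') u = h.actHom f (h.actHom f' u) := by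
  rw [h.actHom_apply f', map_mul, actHom_wedge, actHom_apply, actHom_apply, mul_inv_rev,
    h.isPairing.mul_right, mul_assoc]

theorem actHom_one (h : IsTower d j) (u : E) : h.actHom 1 u = u := by
  rw [actHom_apply, inv_one, h.isPairing.one_right, mul_one]

theorem d_actHom (h : IsTower d j) (f : G) (u : E) : d (h.actHom f u) = f * d u * f⁻¹ := by
  rw [actHom_apply, map_mul, h.d_j, bd_wedge]
  simp only [rcomm]; group

/-- The action of `G` on `E`. -/
def act (h : IsTower d j) : G →* MulAut E where
  toFun f :=
    { h.actHom f with
      invFun := h.actHom f⁻¹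
      left_inv := fun u => by
        change h.actHom f⁻¹ (h.actHom f u) = u
        rw [← h.actHom_mul, inv_mul_cancel, h.actHom_one]
      right_inv := fun u => by
        change h.actHom f (h.actHom f⁻¹ u) = u
        rw [← h.actHom_mul, mul_inv_cancel, h.actHom_one] }
  map_one' := MulEquiv.ext h.actHom_one
  map_mul' f f' := MulEquiv.ext (h.actHom_mul f f')

/-- A tower can be enlarged so that its image in `G` contains a given element. -/
theorem exists_extension (h : IsTower d j) (x : G) : ∃ (E' : Type v) (_ : Group E') (d' : E' →* G)
    (j' : ExteriorSquare q G →* E'), IsTower d' j' ∧ x ∈ d'.range ∧ d.range ≤ d'.range := by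
  -- An infinite cyclic factor is adjoined whatever the order of `x`, so that the quotient by the
  -- exterior square stays torsion-free.
  let φ : Multiplicative ℤ →* MulAut E := h.act.comp (zpowersHom G x)
  let d' : E ⋊[φ] Multiplicative ℤ →* G := SemidirectProduct.lift d (zpowersHom G x) (by
    intro n
    refine MonoidHom.ext fun u => ?_
    exact h.d_actHom _ u)
  let i : E →* E ⋊[φ] Multiplicative ℤ := SemidirectProduct.inl
  let e : E ⋊[φ] Multiplicative ℤ := SemidirectProduct.inr (Multiplicative.ofAdd 1)
  have d_i : ∀ u, d' (i u) = d u := fun u => SemidirectProduct.lift_inl _ _ _ u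
  have d_e : d' e = x := (SemidirectProduct.lift_inr _ _ _ _).trans (by simp)
  have i_inj : Function.Injective i := SemidirectProduct.inl_injective
  have e_conj : ∀ u, rconj (i u) e = i (u * j (wedge q (d u) x)) := by
    intro u
    -- Right conjugation by `e` is the action of `x⁻¹`, hence the exponent `-1`; `actHom` inverts
    -- once more and leaves `x` in the wedge.
    have := SemidirectProduct.inl_aut (φ := φ) (Multiplicative.ofAdd (-1)) u
    have e' : φ (Multiplicative.ofAdd (-1)) u = u * j (wedge q (d u) x) := by
      change h.actHom _ u = _
      simp [h.actHom_apply]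
    rw [e'] at this
    refine Eq.trans ?_ this.symm
    simp only [rconj, e, i, ← map_inv]
    rfl
  have hp : IsPairing q (fun a b => i (j (wedge q a b))) (fun k => i (j (hatE q k))) :=
    h.isPairing.map i
  have gen : Subgroup.closure (Set.range i ∪ {e}) = ⊤ := by
    rw [eq_top_iff]
    rintro y -
    rw [← SemidirectProduct.inl_left_mul_inr_right y]
    refine mul_mem (Subgroup.subset_closure (Or.inl ⟨_, rfl⟩)) ?_
    have : (SemidirectProduct.inr y.right : E ⋊[φ] Multiplicative ℤ) =
        e ^ (Multiplicative.toAdd y.right) := by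
      simp only [e]
      rw [← map_zpow, ← ofAdd_zsmul]
      simp
    have he : e ∈ Subgroup.closure (Set.range i ∪ {e}) :=
      Subgroup.subset_closure (Set.mem_union_right _ (Set.mem_singleton e))
    rw [this]
    exact Subgroup.zpow_mem _ he _
  have hie : ∀ u, rcomm (i u) e = i (j (wedge q (d u) x)) := by
    intro u
    have := e_conj u
    rw [rconj_eq_mul_rcomm, map_mul] at this
    exact mul_left_cancel this
  refine ⟨E ⋊[φ] Multiplicative ℤ, inferInstance, d', i.comp j, ⟨i_inj.comp h.injective, ?_, ?_, ?_⟩,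
    ⟨e, d_e⟩, ?_⟩
  · intro m
    exact (d_i _).trans (h.d_j m)
  · refine hp.rcomm_eq_of_generators d' _ gen ?_ ?_
    · rintro _ (⟨u, rfl⟩ | rfl) a b
      · rw [← map_rconj, h.conj_wedge, d_i]
      · rw [e_conj, hp.conj_eq_mul_rcomm, h.d_j, bd_wedge, d_e, map_mul]
    · rintro _ (⟨u, rfl⟩ | rfl) _ (⟨v, rfl⟩ | rfl)
      · rw [← map_rcomm, h.comm, d_i, d_i]
      · rw [hie, d_i, d_e]
      · rw [← hp.inv_eq_swap, d_i, d_e, ← hie]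
        simp only [rcomm]; group
      · rw [d_e, hp.self]; simp [rcomm]
  · rintro u n hn ⟨m, hm⟩
    -- The image of `j` lies in `E`, so the `ℤ`-component of `u` is killed by `n ≠ 0`; then `u` is
    -- already in `E`, where the old tower applies.
    have hr : u.right ^ n = 1 := by
      have := congrArg (SemidirectProduct.rightHom (φ := φ)) hm
      rw [map_zpow] at this
      exact this.symm.trans (SemidirectProduct.rightHom_inl _)
    have hr1 : u.right = 1 := by
      have := congrArg Multiplicative.toAdd hr
      rw [toAdd_zpow, toAdd_one, smul_eq_mul, mul_eq_zero] at this
      exact Multiplicative.toAdd.injective (this.resolve_left hn)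
    have hu : u = i u.left := by
      conv_lhs => rw [← SemidirectProduct.inl_left_mul_inr_right u, hr1, map_one, mul_one]
    rw [hu, ← map_zpow] at hm
    obtain ⟨m', hm'⟩ := h.torsion_free u.left n hn ⟨m, i_inj hm⟩
    exact ⟨m', by rw [hu, ← hm']; rfl⟩
  · rintro _ ⟨u, rfl⟩
    exact ⟨i u, d_i u⟩

/-- The defect `u ^ q (hat (d u))⁻¹`, a homomorphism into the centre. -/
theorem defect_comm (h : IsTower d j) (u v : E) : Commute (u ^ q * (j (hatE q (d u)))⁻¹) v := by
  -- The defect lies over `1`, since `hat (d u)` has boundary `(d u) ^ q`; its commutators are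
  -- therefore of the form `1 ∧ d v`.
  have h1 : rcomm (u ^ q * (j (hatE q (d u)))⁻¹) v = 1 := by
    rw [h.comm, map_mul, map_inv, h.d_j, bd_hat, map_pow, mul_inv_cancel, h.isPairing.one_left]
  rw [rcomm, mul_assoc, ← mul_inv_rev, inv_mul_eq_one] at h1
  exact h1.symm

/-- The collection formula for `(u v) ^ q` and the relation for `hat (k k₁)` involve the same
product of commutators. It cancels because the defect of `v` is central. -/
theorem defect_mul (h : IsTower d j) (u v : E) : (u * v) ^ q * (j (hatE q (d (u * v))))⁻¹ =
    (u ^ q * (j (hatE q (d u)))⁻¹) * (v ^ q * (j (hatE q (d v)))⁻¹) := by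
  have hl : ∀ i, rcomm (rconj u (u ^ (q - 1 - i))) (rconj ((v ^ i)⁻¹) (u ^ (q - 1 - i))) =
      j (wedge q (rconj (d u) (d u ^ (q - 1 - i)))
        (rconj ((d v ^ i)⁻¹) (d u ^ (q - 1 - i)))) := fun i => by
    rw [h.comm]; simp [map_rconj]
  rw [mul_pow_eq_prod_rcomm, map_mul, h.isPairing.hat_mul]
  simp only [hl]
  generalize (List.map (β := E) _ _).prod = P
  have hc := h.defect_comm v (P⁻¹ * (j (hatE q (d u)))⁻¹)
  calc u ^ q * P * v ^ q * (j (hatE q (d u)) * P * j (hatE q (d v)))⁻¹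
      = u ^ q * P * ((v ^ q * (j (hatE q (d v)))⁻¹) * (P⁻¹ * (j (hatE q (d u)))⁻¹)) := by group
    _ = _ := by rw [hc.eq]; group

/-- The defect as a homomorphism. -/
def defect (h : IsTower d j) : E →* E where
  toFun u := u ^ q * (j (hatE q (d u)))⁻¹
  map_one' := by simp [h.isPairing.hat_one]
  map_mul' := h.defect_mul

theorem defect_apply (h : IsTower d j) (u : E) : h.defect u = u ^ q * (j (hatE q (d u)))⁻¹ := rfl

/-- On `a ∧ b` this is the relation for `hat [a, b]`; on `hat k` it is `hat (k ^ q) = (hat k) ^ q`.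
-/
theorem defect_j (h : IsTower d j) (m : ExteriorSquare q G) : h.defect (j m) = 1 := by
  have : h.defect.comp j = (1 : ExteriorSquare q G →* E) := by
    refine exterior_hom_ext (fun a b => ?_) (fun k => ?_)
    · rw [MonoidHom.comp_apply, defect_apply, h.d_j, bd_wedge, h.isPairing.hat_comm,
        mul_inv_cancel]; rfl
    · rw [MonoidHom.comp_apply, defect_apply, h.d_j, bd_hat, h.isPairing.hat_pow,
        mul_inv_cancel]; rfl
  exact DFunLike.congr_fun this m

/-- For `q ≥ 1` membership puts `u ^ q` into the exterior square, hence also `u` by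
torsion-freeness, and there the defect vanishes. For `q = 0` all defects are trivial. -/
theorem defect_eq_one_of_mem (h : IsTower d j) {u : E} (hu : h.defect u ∈ j.range) :
    h.defect u = 1 := by
  rcases Nat.eq_zero_or_pos q with h0 | hq
  · rw [defect_apply, h.isPairing.hat_zero h0, h0]; simp
  · rw [defect_apply] at hu
    have : u ^ (q : ℤ) ∈ j.range := by
      have := mul_mem hu ⟨hatE q (d u), rfl⟩
      rwa [inv_mul_cancel_right, ← zpow_natCast] at this
    obtain ⟨m, rfl⟩ := h.torsion_free u q (by exact_mod_cast hq.ne') this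
    exact h.defect_j m

/-- A homomorphism `ρ` into a tower kills no elements of the exterior square over `1`. -/
theorem mapE_eq_one (h : IsTower d j) {K : Type w} [Group K] (ρ : K →* E) {m : ExteriorSquare q K}
    (hm : bd q m = 1) : mapE q (d.comp ρ) m = 1 := by
  -- On `a ∧ b` both sides agree without a defect, on `hat k` they differ by that of `ρ k`;
  -- centrality and multiplicativity of the defect carry this to products.
  have key : ∀ m : ExteriorSquare q K, ∃ u, ρ (bd q m) = h.defect u * j (mapE q (d.comp ρ) m) := by
    intro m
    induction m using exterior_induction with
    | wd a b => exact ⟨1, by rw [bd_wedge, map_rcomm, h.comm, mapE_wedge]; simp⟩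
    | ht k => exact ⟨ρ k, by rw [bd_hat, defect_apply, mapE_hat]; simp⟩
    | one => exact ⟨1, by simp⟩
    | mul a b ha hb =>
      obtain ⟨u, hu⟩ := ha
      obtain ⟨v, hv⟩ := hb
      refine ⟨u * v, ?_⟩
      rw [map_mul, map_mul, hu, hv, map_mul, map_mul, map_mul]
      have := (h.defect_comm v (j (mapE q (d.comp ρ) a))).eq
      rw [← defect_apply] at this
      rw [mul_assoc, mul_assoc, ← mul_assoc (j _), ← this, mul_assoc]
    | inv a ha =>
      obtain ⟨u, hu⟩ := ha
      refine ⟨u⁻¹, ?_⟩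
      have := (h.defect_comm u (j (mapE q (d.comp ρ) a))).eq
      rw [← defect_apply] at this
      rw [map_inv, map_inv, hu, this, mul_inv_rev, map_inv, map_inv, map_inv]
  obtain ⟨u, hu⟩ := key m
  rw [hm, map_one] at hu
  have hmem : h.defect u ∈ j.range := by
    rw [eq_inv_of_mul_eq_one_left hu.symm]
    exact inv_mem ⟨_, rfl⟩
  rw [h.defect_eq_one_of_mem hmem, one_mul] at hu
  exact h.injective (by rw [← hu, map_one])

end IsTower

theorem exists_tower (q : ℕ) (G : Type u) [Group G] (S : Finset G) :
    ∃ (E : Type u) (_ : Group E) (d : E →* G) (j : ExteriorSquare q G →* E),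
      IsTower d j ∧ ∀ x ∈ S, x ∈ d.range := by
  classical
  induction S using Finset.induction_on with
  | empty => exact ⟨_, inferInstance, _, _, isTower_id, by simp⟩
  | insert x S _ ih =>
    obtain ⟨E, _, d, j, h, hS⟩ := ih
    obtain ⟨E', i', d', j', h', hx, hle⟩ := h.exists_extension x
    refine ⟨E', i', d', j', h', fun y hy => ?_⟩
    rcases Finset.mem_insert.1 hy with rfl | hy
    · exact hx
    · exact hle (hS y hy)

/-! ### Free groups: injectivity of the boundary map -/

section Free

variable {X : Type u}

open Classical in
/-- The endomorphism of a free group that kills the generators outside `S`. -/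
noncomputable def truncate (S : Finset X) : FreeGroup X →* FreeGroup X :=
  FreeGroup.lift fun x => if x ∈ S then FreeGroup.of x else 1

theorem exists_truncate_eq (g : FreeGroup X) : ∃ S₀ : Finset X, ∀ S, S₀ ⊆ S → truncate S g = g := by
  classical
  induction g using FreeGroup.induction_on with
  | C1 => exact ⟨∅, fun S _ => map_one _⟩
  | of x =>
    refine ⟨{x}, fun S hS => ?_⟩
    simp [truncate, Finset.singleton_subset_iff.1 hS]
  | inv_of x h =>
    obtain ⟨S₀, h⟩ := h
    exact ⟨S₀, fun S hS => by rw [map_inv, h S hS]⟩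
  | mul a b ha hb =>
    obtain ⟨S₀, ha⟩ := ha
    obtain ⟨S₁, hb⟩ := hb
    exact ⟨S₀ ∪ S₁, fun S hS => by
      rw [map_mul, ha S (Finset.union_subset_left hS), hb S (Finset.union_subset_right hS)]⟩

theorem exists_mapE_truncate_eq (m : ExteriorSquare q (FreeGroup X)) :
    ∃ S₀ : Finset X, ∀ S, S₀ ⊆ S → mapE q (truncate S) m = m := by
  classical
  induction m using exterior_induction with
  | wd a b =>
    obtain ⟨S₀, ha⟩ := exists_truncate_eq a
    obtain ⟨S₁, hb⟩ := exists_truncate_eq b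
    exact ⟨S₀ ∪ S₁, fun S hS => by
      rw [mapE_wedge, ha S (Finset.union_subset_left hS), hb S (Finset.union_subset_right hS)]⟩
  | ht k =>
    obtain ⟨S₀, h⟩ := exists_truncate_eq k
    exact ⟨S₀, fun S hS => by rw [mapE_hat, h S hS]⟩
  | one => exact ⟨∅, fun S _ => map_one _⟩
  | mul a b ha hb =>
    obtain ⟨S₀, ha⟩ := ha
    obtain ⟨S₁, hb⟩ := hb
    exact ⟨S₀ ∪ S₁, fun S hS => by
      rw [map_mul, ha S (Finset.union_subset_left hS), hb S (Finset.union_subset_right hS)]⟩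
  | inv a h =>
    obtain ⟨S₀, h⟩ := h
    exact ⟨S₀, fun S hS => by rw [map_inv, h S hS]⟩

/-- The `q`-exterior square of a free group `F` embeds in `F`. -/
theorem bd_injective_of_free (q : ℕ) (X : Type u) :
    Function.Injective (bd q (G := FreeGroup X)) := by
  classical
  rw [injective_iff_map_eq_one]
  intro m hm
  -- Only finitely many basis elements occur in `m`, and towers can be built to reach any finite
  -- set.
  obtain ⟨S, hS⟩ := exists_mapE_truncate_eq m
  obtain ⟨E, _, d, j, h, hd⟩ := exists_tower q (FreeGroup X) (S.image FreeGroup.of)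
  have hd' : ∀ x : X, ∃ u, d u = if x ∈ S then FreeGroup.of x else 1 := by
    intro x
    split_ifs with hx
    · exact hd _ (Finset.mem_image_of_mem _ hx)
    · exact ⟨1, map_one d⟩
  choose s hs using hd'
  -- Freeness of the group is used here: the truncation factors through the tower.
  have ht : truncate S = d.comp (FreeGroup.lift s) := by
    refine FreeGroup.ext_hom _ _ fun x => ?_
    simp [truncate, hs]
  rw [← hS S subset_rfl, ht]
  exact h.mapE_eq_one _ hm

end Free

/-! ### The map from the exterior square of `G` to `F / R^q [R, F]` -/

section Extension

open scoped commutatorElement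

variable {F : Type v} [Group F] {G : Type u} [Group G] (q : ℕ) (π : F →* G)

theorem centralDenom_le_ker : centralDenom q π.ker ≤ π.ker := by
  refine sup_le ?_ (Subgroup.commutator_le_left _ _)
  rw [powSubgroup, Subgroup.closure_le]
  rintro _ ⟨h, hh, rfl⟩
  exact pow_mem hh q

/-- The projection of `F / R^q [R, F]` onto `G`, where `R` is the kernel of `π : F → G`. -/
def projE : EExt q π.ker →* G :=
  QuotientGroup.lift _ π (centralDenom_le_ker q π)

@[simp] theorem projE_mk (f : F) : projE q π (QuotientGroup.mk' _ f) = π f := rfl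

theorem projE_surjective (hπ : Function.Surjective π) : Function.Surjective (projE q π) :=
  fun g => (hπ g).imp' (QuotientGroup.mk' _) fun _ h => h

theorem ker_projE : (projE q π).ker = Tq q π.ker := by
  ext t
  obtain ⟨f, rfl⟩ := QuotientGroup.mk'_surjective _ t
  constructor
  · intro h
    exact ⟨f, h, rfl⟩
  · rintro ⟨r, hr, h⟩
    rw [MonoidHom.mem_ker, ← h]
    exact hr

theorem projE_ker_central (t : EExt q π.ker) (ht : projE q π t = 1) (x : EExt q π.ker) :
    t * x = x * t := by
  obtain ⟨f, rfl⟩ := QuotientGroup.mk'_surjective _ t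
  obtain ⟨y, rfl⟩ := QuotientGroup.mk'_surjective _ x
  have : ⁅f, y⁆ ∈ centralDenom q π.ker :=
    le_sup_right (a := powSubgroup q π.ker) (Subgroup.commutator_mem_commutator ht (Subgroup.mem_top y))
  have h : QuotientGroup.mk' (centralDenom q π.ker) ⁅f, y⁆ = 1 :=
    (QuotientGroup.eq_one_iff _).2 this
  rwa [map_commutatorElement, commutatorElement_eq_one_iff_mul_comm] at h

theorem projE_ker_pow (t : EExt q π.ker) (ht : projE q π t = 1) : t ^ q = 1 := by
  obtain ⟨f, rfl⟩ := QuotientGroup.mk'_surjective _ t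
  have : f ^ q ∈ centralDenom q π.ker :=
    le_sup_left (a := powSubgroup q π.ker) (Subgroup.subset_closure ⟨f, ht, rfl⟩)
  rw [← map_pow]
  exact (QuotientGroup.eq_one_iff _).2 this

variable {π} (hπ : Function.Surjective π)

/-- The homomorphism `g ∧ h ↦ [g̃, h̃]`, `hat k ↦ k̃ ^ q` for lifts `g̃, h̃, k̃`. -/
noncomputable def exteriorToE : ExteriorSquare q G →* EExt q π.ker :=
  (IsPairing.of_central (q := q) (projE q π) (Function.surjInv (projE_surjective q π hπ))
    (Function.surjInv_eq _) (projE_ker_central q π) (projE_ker_pow q π)).lift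

theorem exteriorToE_wedge (x y : EExt q π.ker) :
    exteriorToE q hπ (wedge q (projE q π x) (projE q π y)) = rcomm x y := by
  rw [exteriorToE, IsPairing.lift_wedge]
  exact rcomm_eq_of_central (projE q π) (projE_ker_central q π) (Function.surjInv_eq _ _)
    (Function.surjInv_eq _ _)

theorem exteriorToE_hat (x : EExt q π.ker) :
    exteriorToE q hπ (hatE q (projE q π x)) = x ^ q := by
  rw [exteriorToE, IsPairing.lift_hat]
  exact pow_eq_of_central (projE q π) (projE_ker_central q π) (projE_ker_pow q π)
    (Function.surjInv_eq _ _)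

theorem commutatorElement_eq_rcomm {A : Type*} [Group A] (x y : A) : ⁅x, y⁆ = rcomm x⁻¹ y⁻¹ := by
  simp [commutatorElement_def, rcomm]

theorem range_exteriorToE : (exteriorToE q hπ).range = derivedPow q (EExt q π.ker) := by
  apply le_antisymm
  · rintro _ ⟨m, rfl⟩
    induction m using exterior_induction with
    | wd a b =>
      obtain ⟨x, rfl⟩ := projE_surjective q π hπ a
      obtain ⟨y, rfl⟩ := projE_surjective q π hπ b
      rw [exteriorToE_wedge, ← inv_inv x, ← inv_inv y, ← commutatorElement_eq_rcomm]
      exact le_sup_left (a := commutator (EExt q π.ker))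
        (Subgroup.commutator_mem_commutator (Subgroup.mem_top _) (Subgroup.mem_top _))
    | ht k =>
      obtain ⟨x, rfl⟩ := projE_surjective q π hπ k
      rw [exteriorToE_hat]
      exact le_sup_right (a := commutator (EExt q π.ker))
        (Subgroup.subset_closure ⟨x, trivial, rfl⟩)
    | one => rw [map_one]; exact one_mem _
    | mul a b ha hb => rw [map_mul]; exact mul_mem ha hb
    | inv a ha => rw [map_inv]; exact inv_mem ha
  · refine sup_le ?_ ?_
    · rw [commutator_def, Subgroup.commutator_le]
      rintro x - y -
      exact ⟨_, (exteriorToE_wedge q hπ x⁻¹ y⁻¹).trans (commutatorElement_eq_rcomm x y).symm⟩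
    · rw [powSubgroup, Subgroup.closure_le]
      rintro _ ⟨x, -, rfl⟩
      exact ⟨_, exteriorToE_hat q hπ x⟩

theorem exteriorToE_mapE (m : ExteriorSquare q F) :
    exteriorToE q hπ (mapE q π m) = QuotientGroup.mk' _ (bd q m) := by
  have : (exteriorToE q hπ).comp (mapE q π) = (QuotientGroup.mk' _).comp (bd q) := by
    refine exterior_hom_ext (fun a b => ?_) (fun k => ?_)
    · simp only [MonoidHom.comp_apply, mapE_wedge, bd_wedge, ← projE_mk q π,
        exteriorToE_wedge, map_rcomm]
    · simp only [MonoidHom.comp_apply, mapE_hat, bd_hat, ← projE_mk q π,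
        exteriorToE_hat, map_pow]
  exact DFunLike.congr_fun this m

theorem mapE_surjective (hπ : Function.Surjective π) : Function.Surjective (mapE q π) := by
  intro m
  induction m using exterior_induction with
  | wd a b =>
    obtain ⟨x, rfl⟩ := hπ a
    obtain ⟨y, rfl⟩ := hπ b
    exact ⟨_, mapE_wedge q π x y⟩
  | ht k =>
    obtain ⟨x, rfl⟩ := hπ k
    exact ⟨_, mapE_hat q π x⟩
  | one => exact ⟨1, map_one _⟩
  | mul a b ha hb =>
    obtain ⟨x, rfl⟩ := ha
    obtain ⟨y, rfl⟩ := hb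
    exact ⟨x * y, map_mul _ _ _⟩
  | inv a ha =>
    obtain ⟨x, rfl⟩ := ha
    exact ⟨x⁻¹, map_inv _ _⟩

variable (π) in
/-- `R^q [R, F]` is the image of elements of `F ∧^q F` that vanish in `G ∧^q G`. -/
theorem centralDenom_le_map_ker : centralDenom q π.ker ≤ (mapE q π).ker.map (bd q) := by
  refine sup_le ?_ ?_
  · rw [powSubgroup, Subgroup.closure_le]
    rintro _ ⟨r, hr, rfl⟩
    refine ⟨hatE q r, ?_, bd_hat q r⟩
    rw [SetLike.mem_coe, MonoidHom.mem_ker, mapE_hat, MonoidHom.mem_ker.1 hr,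
      (isPairing_wedge q).hat_one]
  · rw [Subgroup.commutator_le]
    rintro r hr f -
    refine ⟨wedge q r⁻¹ f⁻¹, ?_, by rw [bd_wedge, commutatorElement_eq_rcomm]⟩
    rw [SetLike.mem_coe, MonoidHom.mem_ker, mapE_wedge, map_inv, MonoidHom.mem_ker.1 hr, inv_one,
      (isPairing_wedge q).one_left]

/-- Lift an element of the kernel to `F ∧^q F`. Its boundary lies in `R^q [R, F]`, so it is also the
boundary of an element that dies in `G ∧^q G`; injectivity of `bd` identifies the two. -/
theorem exteriorToE_injective (hF : Function.Injective (bd q (G := F))) :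
    Function.Injective (exteriorToE q hπ) := by
  rw [injective_iff_map_eq_one]
  intro m hm
  obtain ⟨n, rfl⟩ := mapE_surjective q hπ m
  rw [exteriorToE_mapE] at hm
  obtain ⟨n', hn', h⟩ := centralDenom_le_map_ker q π ((QuotientGroup.eq_one_iff _).1 hm)
  rw [← hF h]
  exact hn'

/-- If `F ∧^q F` embeds in `F`, then `G ∧^q G` is isomorphic to `E' E^q` for `E = F / R^q [R, F]`. -/
theorem nonempty_exterior_mulEquiv (hπ : Function.Surjective π)
    (hF : Function.Injective (bd q (G := F))) :
    Nonempty (ExteriorSquare q G ≃* derivedPow q (EExt q π.ker)) :=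
  ⟨(MonoidHom.ofInjective (exteriorToE_injective q hπ hF)).trans
    (MulEquiv.subgroupCongr (range_exteriorToE q hπ))⟩

end Extension

/-! ### Finitely supported functions with values in `ℤ/q` -/

section Coefficients

variable (q : ℕ)

/-- The coefficient group `ℤ/q`, with its universe adjusted. -/
abbrev Coef : Type u := ULift.{u} (ZMod q)

variable {q} {α : Type v} {T : Type w}

/-- The homomorphism on `ℤ/q`-chains with prescribed values of exponent `q`. -/
noncomputable def coefLift [AddCommGroup T] (f : α → T) (hf : ∀ a, q • f a = 0) :
    (α →₀ Coef.{u} q) →+ T :=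
  Finsupp.liftAddHom fun a =>
    (ZMod.lift q ⟨zmultiplesHom T (f a), by simpa using hf a⟩).comp
      (AddEquiv.ulift (α := ZMod q)).toAddMonoidHom

@[simp] theorem coefLift_single [AddCommGroup T] (f : α → T) (hf : ∀ a, q • f a = 0) (a : α) :
    coefLift.{u} f hf (Finsupp.single a 1) = f a := by
  have h : (AddEquiv.ulift (α := ZMod q)) (1 : Coef.{u} q) = ((1 : ℤ) : ZMod q) := by simp; rfl
  simp only [coefLift, Finsupp.liftAddHom_apply_single, AddMonoidHom.comp_apply]
  erw [h, ZMod.lift_coe]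
  simp

theorem coef_hom_ext [AddGroup T] {f f' : (α →₀ Coef.{u} q) →+ T}
    (h : ∀ a, f (Finsupp.single a 1) = f' (Finsupp.single a 1)) : f = f' := by
  refine Finsupp.addHom_ext fun a x => ?_
  obtain ⟨n, hn⟩ := ZMod.intCast_surjective x.down
  have : Finsupp.single a x = n • (Finsupp.single a 1 : α →₀ Coef.{u} q) := by
    rw [Finsupp.smul_single]
    congr 1
    apply ULift.ext
    simp [← hn]
  rw [this, map_zsmul, map_zsmul, h]

theorem coef_nsmul_eq_zero (x : α →₀ Coef.{u} q) : q • x = 0 := by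
  ext a
  simp

end Coefficients

/-! ### Low-degree inhomogeneous chains and `H₂` -/

section Chains

variable (q : ℕ) (G : Type u) [Group G]

/-- The differential from `2`-chains to `1`-chains with coefficients `ℤ/q`. -/
noncomputable def δ₂ : (G × G →₀ Coef.{u} q) →+ (G →₀ Coef.{u} q) :=
  (groupHomology.d₂₁ (Rep.trivial (ULift.{u} ℤ) G (ULift.{u} (ZMod q)))).hom.toAddMonoidHom

/-- The differential from `3`-chains to `2`-chains with coefficients `ℤ/q`. -/
noncomputable def δ₃ : (G × G × G →₀ Coef.{u} q) →+ (G × G →₀ Coef.{u} q) :=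
  (groupHomology.d₃₂ (Rep.trivial (ULift.{u} ℤ) G (ULift.{u} (ZMod q)))).hom.toAddMonoidHom

variable {q G}

theorem δ₂_single (g h : G) (a : Coef.{u} q) : δ₂ q G (Finsupp.single (g, h) a) =
    Finsupp.single h a - Finsupp.single (g * h) a + Finsupp.single g a :=
  groupHomology.d₂₁_single (A := Rep.trivial (ULift.{u} ℤ) G (ULift.{u} (ZMod q))) (g, h) a

theorem δ₃_single (g h k : G) (a : Coef.{u} q) : δ₃ q G (Finsupp.single (g, h, k) a) =
    Finsupp.single (h, k) a - Finsupp.single (g * h, k) a + Finsupp.single (g, h * k) a -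
      Finsupp.single (g, h) a :=
  groupHomology.d₃₂_single (A := Rep.trivial (ULift.{u} ℤ) G (ULift.{u} (ZMod q))) (g, h, k) a

theorem δ₂_δ₃ (x : G × G × G →₀ Coef.{u} q) : δ₂ q G (δ₃ q G x) = 0 := by
  have := groupHomology.d₃₂_apply_mem_cycles₂
    (A := Rep.trivial (ULift.{u} ℤ) G (ULift.{u} (ZMod q))) x
  exact this

-- This presents `H₂` as cycles modulo boundaries, the only form in which homology is used below.
variable (q G) in
theorem exists_H₂_projection : ∃ f : (δ₂ q G).ker →+ H₂ q G, Function.Surjective f ∧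
    ∀ x, f x = 0 ↔ x.1 ∈ (δ₃ q G).range := by
  let A := Rep.trivial (ULift.{u} ℤ) G (ULift.{u} (ZMod q))
  refine ⟨(groupHomology.H2π A).hom.toAddMonoidHom, ?_, ?_⟩
  · intro y
    induction y using groupHomology.H2_induction_on with
    | h x => exact ⟨x, rfl⟩
  · exact fun x => groupHomology.H2π_eq_zero_iff (A := A) x

end Chains

/-! ### Central extensions from cocycles -/

/-- The identity of a `2`-cocycle with values in a trivial module. -/
def IsTwoCocycle {G : Type u} [Group G] {U : Type v} [AddCommGroup U] (c : G → G → U) : Prop :=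
  ∀ g h k, c g h + c (g * h) k = c h k + c g (h * k)

namespace IsTwoCocycle

variable {G : Type u} [Group G] {U : Type v} [AddCommGroup U] {c : G → G → U}

theorem one_left (hc : IsTwoCocycle c) (g : G) : c 1 g = c 1 1 := by
  have := hc 1 1 g
  simpa using this.symm

theorem one_right (hc : IsTwoCocycle c) (g : G) : c g 1 = c 1 1 := by
  have := hc g 1 1
  simp only [mul_one] at this
  exact add_right_cancel this

end IsTwoCocycle

/-- The central extension of `G` by `U` that belongs to a `2`-cocycle. -/
@[ext] structure CocycleExtension {G : Type u} [Group G] {U : Type v} [AddCommGroup U]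
    {c : G → G → U} (hc : IsTwoCocycle c) where
  /-- the component in the module -/
  fst : U
  /-- the component in the group -/
  snd : G

namespace CocycleExtension

variable {G : Type u} [Group G] {U : Type v} [AddCommGroup U] {c : G → G → U}
  {hc : IsTwoCocycle c}

instance : Mul (CocycleExtension hc) := ⟨fun x y => ⟨x.1 + y.1 + c x.2 y.2, x.2 * y.2⟩⟩

/-- Cocycles are not assumed normalised; this is the source of the corrections by `c 1 1` here and
in `incl`. -/
instance : One (CocycleExtension hc) := ⟨⟨-c 1 1, 1⟩⟩

instance : Inv (CocycleExtension hc) := ⟨fun x => ⟨-x.1 - c x.2⁻¹ x.2 - c 1 1, x.2⁻¹⟩⟩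

theorem mul_def (x y : CocycleExtension hc) :
    x * y = ⟨x.1 + y.1 + c x.2 y.2, x.2 * y.2⟩ := rfl

theorem one_def : (1 : CocycleExtension hc) = ⟨-c 1 1, 1⟩ := rfl

theorem inv_def (x : CocycleExtension hc) :
    x⁻¹ = ⟨-x.1 - c x.2⁻¹ x.2 - c 1 1, x.2⁻¹⟩ := rfl

instance : Group (CocycleExtension hc) :=
  Group.ofLeftAxioms
    (fun x y z => by
      simp only [mul_def, mul_assoc, CocycleExtension.mk.injEq, and_true]
      have := hc x.2 y.2 z.2
      calc x.1 + y.1 + c x.2 y.2 + z.1 + c (x.2 * y.2) z.2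
          = x.1 + y.1 + z.1 + (c x.2 y.2 + c (x.2 * y.2) z.2) := by abel
        _ = _ := by rw [this]; abel)
    (fun x => by
      simp only [mul_def, one_def, one_mul, hc.one_left]
      ext <;> simp)
    (fun x => by
      simp only [mul_def, one_def, inv_def, inv_mul_cancel]
      ext
      · dsimp only
        abel
      · rfl)

/-- The projection onto `G`. -/
def proj (hc : IsTwoCocycle c) : CocycleExtension hc →* G where
  toFun := snd
  map_one' := rfl
  map_mul' _ _ := rfl

/-- The inclusion of the module. -/
def incl (hc : IsTwoCocycle c) : U →+ Additive (CocycleExtension hc) where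
  toFun a := Additive.ofMul ⟨a - c 1 1, 1⟩
  map_zero' := by rw [zero_sub]; rfl
  map_add' a b := by
    refine congrArg Additive.ofMul ?_
    change _ = (⟨a - c 1 1, 1⟩ * ⟨b - c 1 1, 1⟩ : CocycleExtension hc)
    rw [mul_def]
    ext
    · dsimp only
      abel
    · simp

theorem toMul_incl (a : U) : (incl hc a).toMul = ⟨a - c 1 1, 1⟩ := rfl

theorem incl_injective : Function.Injective (incl hc) := by
  intro a b h
  have := congrArg (fun x => (Additive.toMul x).fst) h
  simpa [toMul_incl] using this

theorem exists_incl_of_proj {x : CocycleExtension hc} (hx : proj hc x = 1) :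
    ∃ a, x = (incl hc a).toMul := by
  refine ⟨x.1 + c 1 1, ?_⟩
  rw [toMul_incl]
  ext
  · simp
  · exact hx

theorem incl_mul (a : U) (x : CocycleExtension hc) :
    (incl hc a).toMul * x = ⟨a + x.1, x.2⟩ := by
  rw [toMul_incl, mul_def]
  ext
  · simp [hc.one_left]; abel
  · simp

theorem mul_incl (a : U) (x : CocycleExtension hc) :
    x * (incl hc a).toMul = ⟨a + x.1, x.2⟩ := by
  rw [toMul_incl, mul_def]
  ext
  · simp [hc.one_right]; abel
  · simp

end CocycleExtension

/-! ### The subgroup `A' A^q` and lifting to central extensions -/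

/-- A homomorphism with commuting values of exponent `q` vanishes on `A' A^q`. -/
theorem map_derivedPow_eq_one {q : ℕ} {A : Type u} [Group A] {B : Type v} [Group B] (f : A →* B)
    (hf : ∀ x y, f x * f y = f y * f x) (hq : ∀ x, f x ^ q = 1) {t : A}
    (ht : t ∈ derivedPow q A) : f t = 1 := by
  suffices h : derivedPow q A ≤ f.ker from h ht
  refine sup_le ?_ ?_
  · rw [commutator_def, Subgroup.commutator_le]
    rintro x - y -
    rw [MonoidHom.mem_ker, map_commutatorElement, commutatorElement_eq_one_iff_mul_comm, hf]
  · rw [powSubgroup, Subgroup.closure_le]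
    rintro _ ⟨x, -, rfl⟩
    rw [SetLike.mem_coe, MonoidHom.mem_ker, map_pow, hq]

instance (q : ℕ) (A : Type u) [Group A] : (derivedPow q A).Normal := by
  unfold derivedPow; infer_instance

theorem quotient_derivedPow_mul_comm {q : ℕ} {A : Type u} [Group A] (x y : A ⧸ derivedPow q A) :
    x * y = y * x := by
  obtain ⟨a, rfl⟩ := QuotientGroup.mk'_surjective _ x
  obtain ⟨b, rfl⟩ := QuotientGroup.mk'_surjective _ y
  rw [← commutatorElement_eq_one_iff_mul_comm, ← map_commutatorElement]
  exact (QuotientGroup.eq_one_iff _).2 (le_sup_left (a := commutator A)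
    (Subgroup.commutator_mem_commutator (Subgroup.mem_top a) (Subgroup.mem_top b)))

theorem quotient_derivedPow_pow {q : ℕ} {A : Type u} [Group A] (x : A ⧸ derivedPow q A) :
    x ^ q = 1 := by
  obtain ⟨a, rfl⟩ := QuotientGroup.mk'_surjective _ x
  rw [← map_pow]
  exact (QuotientGroup.eq_one_iff _).2 (le_sup_right (a := commutator A)
    (Subgroup.subset_closure ⟨a, trivial, rfl⟩))

/-- The extension `F / R^q [R, F]` for a free group `F` maps to all central extensions of `G` with
a kernel of exponent `q`. -/
theorem exists_lift_EExt {q : ℕ} {G : Type u} [Group G] {X : Type w} (π : FreeGroup X →* G)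
    {H : Type v} [Group H] (p : H →* G) (hp : Function.Surjective p)
    (hc : ∀ t, p t = 1 → ∀ x, t * x = x * t) (hq : ∀ t, p t = 1 → t ^ q = 1) :
    ∃ ψ : EExt q π.ker →* H, ∀ x, p (ψ x) = projE q π x := by
  let ψ₀ : FreeGroup X →* H := FreeGroup.lift fun x => Function.surjInv hp (π (FreeGroup.of x))
  have h₀ : ∀ f, p (ψ₀ f) = π f := by
    have : p.comp ψ₀ = π := FreeGroup.ext_hom _ _ fun x => by
      simp [ψ₀, Function.surjInv_eq hp]
    exact DFunLike.congr_fun this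
  have hker : centralDenom q π.ker ≤ ψ₀.ker := by
    refine sup_le ?_ ?_
    · rw [powSubgroup, Subgroup.closure_le]
      rintro _ ⟨r, hr, rfl⟩
      rw [SetLike.mem_coe, MonoidHom.mem_ker, map_pow, hq _ ((h₀ r).trans hr)]
    · rw [Subgroup.commutator_le]
      rintro r hr f -
      rw [MonoidHom.mem_ker, map_commutatorElement, commutatorElement_eq_one_iff_mul_comm,
        hc _ ((h₀ r).trans hr)]
  refine ⟨QuotientGroup.lift _ ψ₀ hker, fun x => ?_⟩
  obtain ⟨f, rfl⟩ := QuotientGroup.mk'_surjective _ x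
  exact h₀ f

/-! ### Hopf's formula with coefficients in `ℤ/q` -/

section Hopf

variable (q : ℕ) {G : Type u} [Group G] {E : Type v} [Group E] (p : E →* G)

/-- A surjection `E → G` with central kernel of exponent `q`. -/
structure IsCentralExt : Prop where
  surjective : Function.Surjective p
  central : ∀ t, p t = 1 → ∀ x, t * x = x * t
  pow_eq_one : ∀ t, p t = 1 → t ^ q = 1

variable {q p}

instance : CommGroup (Subgroup.center E) :=
  { (inferInstance : Group (Subgroup.center E)) with
    mul_comm := fun a b => Subtype.ext (Subgroup.mem_center_iff.1 b.2 a) }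

theorem coe_toMul_add (x y : Additive (Subgroup.center E)) :
    ((x + y).toMul : E) = x.toMul * y.toMul := rfl

namespace IsCentralExt

variable (h : IsCentralExt q p)

/-- A section of the projection. -/
noncomputable def sec (h : IsCentralExt q p) : G → E := Function.surjInv h.surjective

theorem p_sec (g : G) : p (h.sec g) = g := Function.surjInv_eq _ g

theorem p_cocycle (g k : G) : p (h.sec g * h.sec k * (h.sec (g * k))⁻¹) = 1 := by
  simp [p_sec]

/-- The cocycle of the section, with values in the centre. -/
noncomputable def cocycle (h : IsCentralExt q p) (g k : G) : Additive (Subgroup.center E) :=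
  Additive.ofMul ⟨h.sec g * h.sec k * (h.sec (g * k))⁻¹,
    Subgroup.mem_center_iff.2 fun x => (h.central _ (h.p_cocycle g k) x).symm⟩

theorem coe_cocycle (g k : G) : ((h.cocycle g k).toMul : E) =
    h.sec g * h.sec k * (h.sec (g * k))⁻¹ := rfl

theorem cocycle_mul (g k : G) : ((h.cocycle g k).toMul : E) * h.sec (g * k) =
    h.sec g * h.sec k := by
  rw [coe_cocycle, inv_mul_cancel_right]

theorem isTwoCocycle : IsTwoCocycle h.cocycle := by
  intro g k l
  apply Additive.toMul.injective
  apply Subtype.ext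
  rw [coe_toMul_add, coe_toMul_add]
  apply mul_right_cancel (b := h.sec (g * k * l))
  have hcomm := h.central _ (h.p_cocycle k l) (h.sec g)
  rw [← coe_cocycle] at hcomm
  have hr : ((h.cocycle k l).toMul : E) * (h.cocycle g (k * l)).toMul * h.sec (g * (k * l)) =
      h.sec g * h.sec k * h.sec l := by
    rw [mul_assoc, h.cocycle_mul, ← mul_assoc, hcomm, mul_assoc, h.cocycle_mul, mul_assoc]
  rw [mul_assoc g, hr, ← mul_assoc g, mul_assoc, h.cocycle_mul, ← mul_assoc, h.cocycle_mul]

theorem nsmul_cocycle (g k : G) : q • h.cocycle g k = 0 := by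
  apply Additive.toMul.injective
  apply Subtype.ext
  rw [toMul_nsmul, Subgroup.coe_pow, coe_cocycle, h.pow_eq_one _ (h.p_cocycle g k)]
  rfl

/-- The map from `2`-chains to the centre given by the cocycle. -/
noncomputable def chainHom (h : IsCentralExt q p) :
    (G × G →₀ Coef.{u} q) →+ Additive (Subgroup.center E) :=
  coefLift (fun x => h.cocycle x.1 x.2) fun x => h.nsmul_cocycle x.1 x.2

theorem chainHom_δ₃ (x : G × G × G →₀ Coef.{u} q) : h.chainHom (δ₃ q G x) = 0 := by
  have : h.chainHom.comp (δ₃ q G) = 0 := by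
    refine coef_hom_ext fun ⟨g, k, l⟩ => ?_
    have hc := h.isTwoCocycle g k l
    simp only [AddMonoidHom.comp_apply, δ₃_single, map_sub, map_add, chainHom, coefLift_single,
      AddMonoidHom.zero_apply]
    rw [sub_eq_zero, sub_add_eq_add_sub, ← hc]
    abel
  exact DFunLike.congr_fun this x

/-- The map from `2`-chains to `E` given by the cocycle. -/
noncomputable def chainToE (h : IsCentralExt q p) : (G × G →₀ Coef.{u} q) →+ Additive E :=
  (MonoidHom.toAdditive (Subgroup.center E).subtype).comp h.chainHom

theorem chainToE_single (g k : G) : h.chainToE (Finsupp.single (g, k) 1) =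
    Additive.ofMul (h.sec g * h.sec k * (h.sec (g * k))⁻¹) := by
  rw [chainToE, AddMonoidHom.comp_apply, chainHom, coefLift_single]
  rfl

theorem chainToE_eq_zero {x : G × G →₀ Coef.{u} q} (hx : x ∈ (δ₃ q G).range) :
    h.chainToE x = 0 := by
  obtain ⟨y, rfl⟩ := hx
  rw [chainToE, AddMonoidHom.comp_apply, chainHom_δ₃, map_zero]

theorem p_chainToE (x : G × G →₀ Coef.{u} q) : p (h.chainToE x).toMul = 1 := by
  have : (MonoidHom.toAdditive p).comp h.chainToE = 0 := by
    refine coef_hom_ext fun ⟨g, k⟩ => ?_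
    rw [AddMonoidHom.comp_apply, chainToE_single]
    exact h.p_cocycle g k
  exact DFunLike.congr_fun this x

/-- Modulo `E' E^q`, which has an abelian quotient of exponent `q`, the cocycle is the coboundary of
the section. The induced map on chains therefore factors through `δ₂` and vanishes on cycles. -/
theorem chainToE_mem_derivedPow {x : G × G →₀ Coef.{u} q} (hx : δ₂ q G x = 0) :
    (h.chainToE x).toMul ∈ derivedPow q E := by
  let _ : CommGroup (E ⧸ derivedPow q E) :=
    { (inferInstance : Group (E ⧸ derivedPow q E)) with
      mul_comm := quotient_derivedPow_mul_comm }
  let m : E →* E ⧸ derivedPow q E := QuotientGroup.mk' _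
  let S : (G →₀ Coef.{u} q) →+ Additive (E ⧸ derivedPow q E) :=
    coefLift (fun g => Additive.ofMul (m (h.sec g))) fun g => quotient_derivedPow_pow (m (h.sec g))
  have hS : ∀ g, S (Finsupp.single g 1) = Additive.ofMul (m (h.sec g)) :=
    coefLift_single _ _
  have key : (MonoidHom.toAdditive m).comp h.chainToE = S.comp (δ₂ q G) := by
    refine coef_hom_ext fun ⟨g, k⟩ => ?_
    rw [AddMonoidHom.comp_apply, chainToE_single, AddMonoidHom.comp_apply, δ₂_single, map_add,
      map_sub, hS, hS, hS]
    change Additive.ofMul (m (h.sec g * h.sec k * (h.sec (g * k))⁻¹)) = _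
    rw [m.map_mul, m.map_mul, m.map_inv, ofMul_mul, ofMul_mul, ofMul_inv]
    abel
  have := DFunLike.congr_fun key x
  rw [AddMonoidHom.comp_apply, AddMonoidHom.comp_apply, hx, map_zero] at this
  exact (QuotientGroup.eq_one_iff _).1 this

/-- The `2`-chains modulo boundaries. -/
def ChainQuotient (q : ℕ) (G : Type u) [Group G] : Type u :=
  (G × G →₀ Coef.{u} q) ⧸ (δ₃ q G).range

noncomputable instance (q : ℕ) (G : Type u) [Group G] : AddCommGroup (ChainQuotient q G) :=
  inferInstanceAs (AddCommGroup ((G × G →₀ Coef.{u} q) ⧸ (δ₃ q G).range))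

/-- The class of a `2`-chain modulo boundaries. -/
noncomputable def chainMk (q : ℕ) (G : Type u) [Group G] :
    (G × G →₀ Coef.{u} q) →+ ChainQuotient q G :=
  QuotientAddGroup.mk' (δ₃ q G).range

theorem chainMk_surjective : Function.Surjective (chainMk q G) :=
  QuotientAddGroup.mk'_surjective _

theorem chainMk_eq_zero_iff {x : G × G →₀ Coef.{u} q} :
    chainMk q G x = 0 ↔ x ∈ (δ₃ q G).range :=
  QuotientAddGroup.eq_zero_iff x

/-- Homomorphisms on chains modulo boundaries. -/
noncomputable def chainQuotientLift {T : Type w} [AddCommGroup T] (f : (G × G →₀ Coef.{u} q) →+ T)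
    (hf : ∀ x, f (δ₃ q G x) = 0) : ChainQuotient q G →+ T :=
  QuotientAddGroup.lift (δ₃ q G).range f (by rintro _ ⟨z, rfl⟩; exact hf z)

/-- The cocycle `(g, h) ↦ [(g, h)]` with values in the `2`-chains modulo boundaries. -/
noncomputable def univCocycle (q : ℕ) {G : Type u} [Group G] (g k : G) :
    ChainQuotient q G :=
  chainMk q G (Finsupp.single (g, k) 1)

theorem isTwoCocycle_univ (q : ℕ) {G : Type u} [Group G] :
    IsTwoCocycle (univCocycle q (G := G)) := by
  intro g k l
  have : chainMk q G (δ₃ q G (Finsupp.single (g, k, l) 1)) = 0 :=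
    chainMk_eq_zero_iff.2 ⟨_, rfl⟩
  rw [δ₃_single, map_sub, map_add, map_sub, sub_eq_zero] at this
  simp only [univCocycle]
  rw [← this]
  abel

theorem univ_nsmul_eq_zero (y : ChainQuotient q G) : q • y = 0 := by
  obtain ⟨x, rfl⟩ := chainMk_surjective y
  rw [← map_nsmul, coef_nsmul_eq_zero, map_zero]

open CocycleExtension in
theorem isCentralExt_univ (q : ℕ) {G : Type u} [Group G] :
    IsCentralExt q (proj (isTwoCocycle_univ q (G := G))) where
  surjective g := ⟨⟨0, g⟩, rfl⟩
  central t ht x := by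
    obtain ⟨a, rfl⟩ := exists_incl_of_proj ht
    rw [incl_mul, mul_incl]
  pow_eq_one t ht := by
    obtain ⟨a, rfl⟩ := exists_incl_of_proj ht
    rw [← toMul_nsmul, ← map_nsmul, univ_nsmul_eq_zero, map_zero, toMul_zero]

open CocycleExtension in
/-- If `E` maps to the universal extension, then a `2`-cycle that vanishes in `E` is a boundary. -/
theorem mem_range_δ₃ (ψ : E →* CocycleExtension (isTwoCocycle_univ q (G := G)))
    (hψ : ∀ x, (ψ x).snd = p x) {x : G × G →₀ Coef.{u} q} (hx : δ₂ q G x = 0)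
    (h0 : h.chainToE x = 0) : x ∈ (δ₃ q G).range := by
  let C : (G →₀ Coef.{u} q) →+ ChainQuotient q G :=
    coefLift (fun g => (ψ (h.sec g)).fst) fun g => univ_nsmul_eq_zero _
  have hC : ∀ g, C (Finsupp.single g 1) = (ψ (h.sec g)).fst := coefLift_single _ _
  -- The two sections of the universal extension, `ψ ∘ sec` and the tautological one, differ by the
  -- cochain `C`, so their cocycles differ by its coboundary, which is invisible on cycles.
  have key : (MonoidHom.toAdditive ψ).comp h.chainToE =
      (incl (isTwoCocycle_univ q)).comp (chainMk q G + C.comp (δ₂ q G)) := by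
    refine coef_hom_ext fun ⟨g, k⟩ => ?_
    rw [AddMonoidHom.comp_apply, chainToE_single, AddMonoidHom.comp_apply, AddMonoidHom.add_apply,
      AddMonoidHom.comp_apply,
      δ₂_single, C.map_add, C.map_sub, hC, hC, hC]
    apply Additive.toMul.injective
    change ψ (h.sec g * h.sec k * (h.sec (g * k))⁻¹) = _
    rw [map_mul, map_inv, mul_inv_eq_iff_eq_mul, incl_mul, map_mul, mul_def]
    ext
    · simp only [hψ, p_sec, univCocycle]
      abel
    · simp only [hψ, p_sec]
  have := DFunLike.congr_fun key x
  rw [AddMonoidHom.comp_apply, h0, map_zero, AddMonoidHom.comp_apply, AddMonoidHom.add_apply,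
      AddMonoidHom.comp_apply, hx,
    map_zero, add_zero] at this
  have h1 := incl_injective (this.symm.trans (map_zero _).symm)
  exact chainMk_eq_zero_iff.1 h1

open CocycleExtension in
/-- If `E` maps to the universal extension, then the elements of `E' E^q` over `1` come from
`2`-cycles. -/
theorem exists_cycle (ψ : E →* CocycleExtension (isTwoCocycle_univ q (G := G)))
    (hψ : ∀ x, (ψ x).snd = p x) {t : E} (ht : t ∈ derivedPow q E) (hpt : p t = 1) :
    ∃ x : G × G →₀ Coef.{u} q, δ₂ q G x = 0 ∧ (h.chainToE x).toMul = t := by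
  obtain ⟨y, hy⟩ := exists_incl_of_proj (x := ψ t) ((hψ t).trans hpt)
  obtain ⟨x, rfl⟩ := chainMk_surjective y
  let D : ChainQuotient q G →+ (G →₀ Coef.{u} q) :=
    chainQuotientLift (δ₂ q G) δ₂_δ₃
  let Φ : ChainQuotient q G →+ Additive (Subgroup.center E) :=
    chainQuotientLift h.chainHom h.chainHom_δ₃
  have D_mk : ∀ z, D (chainMk q G z) = δ₂ q G z := fun z => rfl
  have Φ_mk : ∀ z, Φ (chainMk q G z) = h.chainHom z := fun z => rfl
  have D_univ : ∀ g k : G, D (univCocycle q g k) =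
      Finsupp.single k 1 - Finsupp.single (g * k) 1 + Finsupp.single g 1 := fun g k => by
    rw [univCocycle, D_mk, δ₂_single]
  have Φ_univ : ∀ g k : G, Φ (univCocycle q g k) = h.cocycle g k := fun g k => by
    rw [univCocycle, Φ_mk, chainHom, coefLift_single]
  refine ⟨x, ?_, ?_⟩
  -- The map `(y, g) ↦ D y + [g]` is a homomorphism to an abelian group of exponent `q`, so it kills
  -- `ψ t`. The `-c 1 1` inside `incl` contributes `-[1]`, which cancels the `[g]` at `g = 1` and
  -- leaves `δ₂ x = 0`.
  · let χ : CocycleExtension (isTwoCocycle_univ q (G := G)) →*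
        Multiplicative (G →₀ Coef.{u} q) := MonoidHom.mk'
      (fun e => Multiplicative.ofAdd (D e.1 + Finsupp.single e.2 1)) (fun a b => by
        rw [← ofAdd_add, mul_def]
        refine congrArg Multiplicative.ofAdd ?_
        rw [map_add, map_add, D_univ]
        abel)
    have h1 : (χ.comp ψ) t = 1 :=
      map_derivedPow_eq_one (χ.comp ψ) (fun _ _ => mul_comm _ _)
        (fun _ => coef_nsmul_eq_zero (q := q) _) ht
    rw [MonoidHom.comp_apply, hy, toMul_incl] at h1
    have h2 : D (chainMk q G x - univCocycle q 1 1) + Finsupp.single (1 : G) 1 = 0 := h1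
    rw [map_sub, D_univ, D_mk, mul_one] at h2
    simpa using h2
  -- Pushing the universal cocycle forward to the cocycle of `E` gives a homomorphism back to `E`
  -- over `G`.
  · let ε : CocycleExtension (isTwoCocycle_univ q (G := G)) →* E := MonoidHom.mk'
      (fun e => ((Φ e.1).toMul : E) * h.sec e.2) (fun a b => by
        rw [mul_def, Φ.map_add, Φ.map_add, Φ_univ, coe_toMul_add, coe_toMul_add, mul_assoc,
          h.cocycle_mul]
        have := Subgroup.mem_center_iff.1 (Φ b.1).toMul.2 (h.sec a.2)
        rw [mul_assoc, mul_assoc, ← mul_assoc _ (h.sec a.2), ← this, mul_assoc])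
    have p_Φ : ∀ y, p ((Φ y).toMul : E) = 1 := fun y => by
      obtain ⟨z, rfl⟩ := chainMk_surjective y
      exact h.p_chainToE z
    have p_ε : ∀ e, p (ε (ψ e)) = p e := fun e => by
      change p (((Φ (ψ e).1).toMul : E) * h.sec (ψ e).2) = p e
      rw [map_mul, p_Φ, one_mul, p_sec, hψ]
    have p_div : ∀ e, p (ε (ψ e) * e⁻¹) = 1 := fun e => by simp [p_ε]
    -- Two endomorphisms of `E` over `G` differ by a homomorphism into the central kernel of
    -- exponent `q`, which is trivial on `E' E^q`; hence `ε (ψ t) = t`.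
    let d : E →* E := MonoidHom.mk' (fun e => ε (ψ e) * e⁻¹) (fun a b => by
      rw [map_mul, map_mul, mul_inv_rev]
      have := h.central _ (p_div b) a⁻¹
      calc ε (ψ a) * ε (ψ b) * (b⁻¹ * a⁻¹) = ε (ψ a) * (ε (ψ b) * b⁻¹ * a⁻¹) := by group
        _ = _ := by rw [this]; group)
    have h1 : d t = 1 := map_derivedPow_eq_one d (fun a b => h.central _ (p_div a) _)
      (fun a => h.pow_eq_one _ (p_div a)) ht
    have h2 : ε (ψ t) = t := mul_inv_eq_one.1 h1
    rw [hy, toMul_incl] at h2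
    -- The cocycle of `E` at `(1, 1)` equals `sec 1`, so the correction in `incl` cancels the factor
    -- `h.sec 1`.
    have h3 : ((Φ (chainMk q G x - univCocycle q 1 1)).toMul : E) * h.sec 1 = t := h2
    rw [map_sub, Φ_univ, Φ_mk, toMul_sub, Subgroup.coe_div, coe_cocycle] at h3
    rw [← h3, mul_one]
    simp only [mul_inv_cancel_right, div_mul_cancel]
    rfl

end IsCentralExt

theorem isCentralExt_projE (q : ℕ) {F : Type v} [Group F] (π : F →* G)
    (hπ : Function.Surjective π) : IsCentralExt q (projE q π) :=
  ⟨projE_surjective q π hπ, projE_ker_central q π, projE_ker_pow q π⟩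

/-- Hopf's formula with coefficients in `ℤ/q`. -/
theorem nonempty_H₂_mulEquiv (q : ℕ) {X : Type w} (π : FreeGroup X →* G)
    (hπ : Function.Surjective π) :
    Nonempty (Multiplicative (H₂ q G) ≃*
      (derivedPow q (EExt q π.ker) ⊓ Tq q π.ker : Subgroup (EExt q π.ker))) := by
  have h := isCentralExt_projE q π hπ
  have hu := IsCentralExt.isCentralExt_univ q (G := G)
  obtain ⟨ψ, hψ⟩ := exists_lift_EExt (q := q) π _ hu.surjective hu.central hu.pow_eq_one
  obtain ⟨f, hf, hf0⟩ := exists_H₂_projection q G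
  let f' : Multiplicative (δ₂ q G).ker →* Multiplicative (H₂ q G) := AddMonoidHom.toMultiplicative f
  let Θ : Multiplicative (δ₂ q G).ker →* EExt q π.ker :=
    AddMonoidHom.toMultiplicativeLeft (h.chainToE.comp (δ₂ q G).ker.subtype)
  have Θ_apply : ∀ x : (δ₂ q G).ker, Θ (Multiplicative.ofAdd x) = (h.chainToE x.1).toMul :=
    fun _ => rfl
  have hker : f'.ker = Θ.ker := by
    ext x
    rw [MonoidHom.mem_ker, MonoidHom.mem_ker]
    change f x.toAdd = 0 ↔ h.chainToE x.toAdd.1 = 0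
    rw [hf0]
    exact ⟨h.chainToE_eq_zero, h.mem_range_δ₃ ψ hψ x.toAdd.2⟩
  have hrange : Θ.range = derivedPow q (EExt q π.ker) ⊓ Tq q π.ker := by
    rw [← ker_projE]
    ext t
    constructor
    · rintro ⟨x, rfl⟩
      exact ⟨h.chainToE_mem_derivedPow x.toAdd.2, h.p_chainToE _⟩
    · rintro ⟨ht, hpt⟩
      obtain ⟨x, hx, rfl⟩ := h.exists_cycle ψ hψ ht hpt
      exact ⟨Multiplicative.ofAdd ⟨x, hx⟩, rfl⟩
  exact ⟨(QuotientGroup.quotientKerEquivOfSurjective f' hf).symm.trans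
    ((QuotientGroup.quotientMulEquivOfEq hker).trans
      ((QuotientGroup.quotientKerEquivRange Θ).trans (MulEquiv.subgroupCongr hrange)))⟩

end Hopf

end QExterior

theorem mainTheorem4 (q : ℕ) {G : Type*} [Group G] {X : Type*}
    (π : FreeGroup X →* G) (hπ : Function.Surjective π) :
    Nonempty (QExterior.ExteriorSquare q G ≃*
      QExterior.derivedPow q (QExterior.EExt q π.ker)) ∧
    Nonempty (Multiplicative (QExterior.H₂ q G) ≃*
      (QExterior.derivedPow q (QExterior.EExt q π.ker) ⊓ QExterior.Tq q π.ker :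
        Subgroup (QExterior.EExt q π.ker))) :=
  ⟨QExterior.nonempty_exterior_mulEquiv q hπ (QExterior.bd_injective_of_free q X),
    QExterior.nonempty_H₂_mulEquiv q π hπ⟩
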